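/- Let $D$ be a positive definite symmetric real $3\times 3$ matrix and let $f:\mathbb R^3\to\mathbb R^3$, $f(u)=\varphi(|u|^2)u$, where $\varphi\in C^1((0,\infty))$ and, for some exponent $l\in(0,2]$ and positive constants $\alpha,\kappa,C_0,C_1$ and all $z>0$, $$\kappa-C_0z^{-1/2}\le\varphi'(z)\le C_1z^{-1/2}(1+z^{3/2}),\qquad -C_0+\alpha z^l\le\varphi(z)\le C_0(1+z^l).$$ For a bounded domain $\Omega\subset\mathbb R^3$ let $E=L^2(\Omega)^3\times\{p\in L^2(\Omega):\int_\Omega p\,dx=0\}$ with norm $\|(u,p)\|_E^2=\|u\|_{L^2}^2+\|p\|_{L^2}^2$. For $g\in L^2(\Omega)^3$ and $T>0$, a weak energy solution on $[0,T]$ of $$\partial_tu-\Delta u+\nabla p+f(u)=g,\quad u|_{\partial\Omega}=0,\qquad \partial_tp+\operatorname{div}(Du)=0$$ is a function $(u,p):[0,T]\to E$, weakly continuous on $[0,T]$, such that $u\in L^2(0,T;H^1_0(\Omega))\cap L^{2(l+1)}(0,T;L^{2(l+1)}(\Omega))$ and both equations hold in the sense of distributions on $(0,T)\times\Omega$. Then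 there are positive constants $C$ and $K$, depending only on $f$ and $D$, such that for every bounded domain $\Omega\subset\mathbb R^3$, every $g\in L^2(\Omega)^3$, every $T>0$, any two weak energy solutions $(u_1,p_1)$, $(u_2,p_2)$ on $[0,T]$ (with the same $f$, $D$, $g$) and all $t\in[0,T]$, $$\|(u_1(t)-u_2(t),p_1(t)-p_2(t))\|_E^2\le Ce^{Kt}\|(u_1(0)-u_2(0),p_1(0)-p_2(0))\|_E^2 .$$ In particular, two weak energy solutions with the same initial data coincide on $[0,T]$. -/

import Mathlib

open Set Filter Topology MeasureTheory
open scoped ContDiff Matrix Gradient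

noncomputable section

namespace BrinkmanForchheimer

/-- Three-dimensional Euclidean space: physical space and the space of velocity vectors. -/
abbrev V : Type := EuclideanSpace ℝ (Fin 3)

/-- `f` is a Brinkman-Forchheimer nonlinearity with exponent `l`: `f(u) = φ(|u|²) u`,
where `φ ∈ C¹((0, ∞))` obeys the growth conditions. -/
def IsNonlinearity (l : ℝ) (f : V → V) : Prop :=
  l ∈ Ioc (0 : ℝ) 2 ∧
  ∃ φ : ℝ → ℝ, ContDiffOn ℝ 1 φ (Ioi 0) ∧
    (∀ u : V, f u = φ (‖u‖ ^ 2) • u) ∧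
    ∃ α κ C C₁ : ℝ, 0 < α ∧ 0 < κ ∧ 0 < C ∧ 0 < C₁ ∧
      ∀ z : ℝ, 0 < z →
        (κ - C * z ^ (-(1 / 2) : ℝ) ≤ deriv φ z ∧
          deriv φ z ≤ C₁ * z ^ (-(1 / 2) : ℝ) * (1 + z ^ (3 / 2 : ℝ))) ∧
        (-C + α * z ^ l ≤ φ z ∧ φ z ≤ C * (1 + z ^ l))

/-- The Lebesgue space `L²(Ω; F)`. -/
abbrev L2 (Ω : Set V) (F : Type) [NormedAddCommGroup F] : Type :=
  Lp F 2 (volume.restrict Ω : Measure V)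

/-- The mean-zero functions in `L²(Ω)`. (On a bounded `Ω` integrability is automatic.) -/
def L2bar (Ω : Set V) : Submodule ℝ (L2 Ω ℝ) where
  carrier := {p | Integrable p (volume.restrict Ω) ∧ ∫ x in Ω, p x = 0}
  zero_mem' := by
    have h := Lp.coeFn_zero ℝ 2 (volume.restrict Ω : Measure V)
    exact ⟨(integrable_zero V ℝ _).congr h.symm, by rw [integral_congr_ae h]; simp⟩
  add_mem' := by
    rintro p q ⟨hp, hp0⟩ ⟨hq, hq0⟩
    have h := Lp.coeFn_add p q
    refine ⟨(hp.add hq).congr h.symm, ?_⟩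
    rw [integral_congr_ae h]
    simp only [Pi.add_apply]
    rw [integral_add hp hq, hp0, hq0, add_zero]
  smul_mem' := by
    rintro c p ⟨hp, hp0⟩
    have h := Lp.coeFn_smul c p
    refine ⟨(hp.smul c).congr h.symm, ?_⟩
    rw [integral_congr_ae h]
    simp only [Pi.smul_apply]
    rw [integral_smul, hp0, smul_zero]

/-- The energy phase space: `L²(Ω; ℝ³)` times the mean-zero part of `L²(Ω)`, with the norm
`‖(u, p)‖² = ‖u‖² + ‖p‖²`. -/
abbrev E (Ω : Set V) : Type := WithLp 2 (L2 Ω V × L2bar Ω)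

/-- The graph of the gradient on `H¹₀(Ω; ℝ³)`: pairs `(v, (∂₁v, ∂₂v, ∂₃v))` with `v ∈ H¹₀`,
where `H¹₀` is the closure of the smooth compactly supported fields in the `H¹` topology. -/
def H10Graph (Ω : Set V) : Set (L2 Ω V × (Fin 3 → L2 Ω V)) :=
  closure {vw | ∃ φ : V → V, ContDiff ℝ ∞ φ ∧ HasCompactSupport φ ∧ tsupport φ ⊆ Ω ∧
    vw.1 =ᵐ[volume.restrict Ω] φ ∧
    ∀ i, vw.2 i =ᵐ[volume.restrict Ω] fun x => fderiv ℝ φ x (EuclideanSpace.single i 1)}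

/-- `u ∈ L²(0, T; H¹₀(Ω))`. -/
def MemL2H10 (Ω : Set V) (T : ℝ) (u : ℝ → L2 Ω V) : Prop :=
  ∃ G : ℝ → Fin 3 → L2 Ω V,
    MemLp (fun t => (u t, G t)) 2 (volume.restrict (Ioo 0 T)) ∧
    ∀ᵐ t ∂(volume.restrict (Ioo 0 T)), (u t, G t) ∈ H10Graph Ω

/-- Test functions on the space-time cylinder `(0, T) × Ω`. -/
def IsTest (Ω : Set V) (T : ℝ) {F : Type} [NormedAddCommGroup F] [NormedSpace ℝ F]
    (ψ : ℝ × V → F) : Prop :=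
  ContDiff ℝ ∞ ψ ∧ HasCompactSupport ψ ∧ tsupport ψ ⊆ Ioo 0 T ×ˢ Ω

/-- The time derivative of a function on space-time. -/
def dt {F : Type} [NormedAddCommGroup F] [NormedSpace ℝ F] (ψ : ℝ × V → F) (t : ℝ) (x : V) : F :=
  deriv (fun s => ψ (s, x)) t

/-- The divergence of a vector field. -/
def divergence (φ : V → V) (x : V) : ℝ :=
  ∑ i, fderiv ℝ φ x (EuclideanSpace.single i 1) i

/-- `∂ₜu - Δu + ∇p + f(u) = g` in the sense of distributions on `(0, T) × Ω`. -/
def MomentumEq (Ω : Set V) (T : ℝ) (f : V → V) (g : L2 Ω V) (U : ℝ → E Ω) : Prop :=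
  ∀ ψ : ℝ × V → V, IsTest Ω T ψ →
    ∫ t in Ioo 0 T, ∫ x in Ω,
      (-inner ℝ ((U t).fst x) (dt ψ t x)
        - inner ℝ ((U t).fst x) (Laplacian.laplacian (fun y => ψ (t, y)) x)
        - ((U t).snd : L2 Ω ℝ) x * divergence (fun y => ψ (t, y)) x
        + inner ℝ (f ((U t).fst x)) (ψ (t, x))
        - inner ℝ (g x) (ψ (t, x))) = 0

/-- `∂ₜp + div(Du) = 0` in the sense of distributions on `(0, T) × Ω`. -/
def PressureEq (Ω : Set V) (T : ℝ) (D : Matrix (Fin 3) (Fin 3) ℝ) (U : ℝ → E Ω) : Prop :=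
  ∀ χ : ℝ × V → ℝ, IsTest Ω T χ →
    ∫ t in Ioo 0 T, ∫ x in Ω,
      (-(((U t).snd : L2 Ω ℝ) x * dt χ t x)
        - inner ℝ (Matrix.toEuclideanLin D ((U t).fst x)) (∇ (fun y => χ (t, y)) x)) = 0

/-- `U = (u, p)` is a weak energy solution on `[0, T]`: it is weakly continuous on `[0, T]` with
values in `E`, `u ∈ L²(0, T; H¹₀) ∩ L^{2(l+1)}(0, T; L^{2(l+1)})`, and both equations hold in the
sense of distributions. Its initial data are `U 0`. -/
structure IsWeakEnergySolution (Ω : Set V) (T l : ℝ) (f : V → V)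
    (D : Matrix (Fin 3) (Fin 3) ℝ) (g : L2 Ω V) (U : ℝ → E Ω) : Prop where
  weakly_continuous : ∀ w : E Ω, ContinuousOn (fun t => inner ℝ w (U t)) (Icc 0 T)
  memL2H10 : MemL2H10 Ω T (fun t => (U t).fst)
  memLq : ∫⁻ t in Ioo 0 T, ∫⁻ x in Ω, ‖(U t).fst x‖ₑ ^ (2 * (l + 1)) < ⊤
  momentum : MomentumEq Ω T f g U
  pressure : PressureEq Ω T D U

end BrinkmanForchheimer

end

noncomputable section

namespace BrinkmanForchheimer

/-! Let `(w, q)` be the difference of two solutions. Formally, testing its momentum equation with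
`w` and its pressure equation with `q` gives `½ d/dt ‖(w, q)‖² = -‖∇w‖² + (q, div w) - (div(Dw), q)
- (f(u₁) - f(u₂), w)`. Two facts close the estimate. The nonlinearity is monotone up to a linear
term (`IsNonlinearity.inner_sub_ge`). The two pressure terms are `q` times a linear expression in
`∇w`, so completing the square absorbs them in the dissipation at the cost of a multiple of `‖q‖²`
(`pointwise_energy_bound`). Gronwall's inequality (`le_two_mul_exp_of_integral_le`) then finishes
the proof.

The work lies in justifying the test, since solutions are only weakly continuous and solve the
equations as distributions. As `l ≤ 2`, one has `2(l+1) ≤ 6`, so `H¹₀` embeds in `L^{2(l+1)}`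
(`exists_eLpNorm_le_of_mem_H10Graph`), while `f(u)` lies in the dual Lebesgue space; thus the
nonlinear terms can be paired with `H¹₀` fields. Product test functions and
`sub_eq_integral_of_distributional_deriv` turn the equations into formulas for time increments
tested with a fixed smooth function. These extend to `H¹₀` fields (`momentum_increment`) and,
because `div(Dw)` is square integrable, to all `L²` functions for the pressure
(`pressure_increment`). For almost every `r` the difference `W(r)` is itself admissible, whence
`⟨W(r) - W(s), W(r)⟩ = ∫_s^r B(σ, r) dσ`, where `B` is `DifferenceReps.kernel` (`inner_increment`).

The chain rule for `‖W‖²` is replaced by `‖W(r)‖² - ‖W(r-δ)‖² ≤ 2⟨W(r) - W(r-δ), W(r)⟩`. Integrating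
over `r ∈ (0, c)` leaves the mean of `‖W‖²` over `(c-δ, c)` and the value at `0`, bounded through
the shifted diagonals `B(r-θ, r)` with `0 < θ ≤ δ`. As `δ → 0`, continuity of translations in `Lᵖ`
leads to the diagonal `B(r, r)`, and weak lower semicontinuity of the norm handles the left side.
The result is an energy inequality at every time (`energy_inequality`). -/

/-! ### Monotonicity, growth and measurability of the nonlinearity -/

/-- The square of a difference of norms is at most the square of the norm of the difference. -/
lemma sq_norm_sub_norm_le (u v : V) : (‖u‖ - ‖v‖) ^ 2 ≤ ‖u - v‖ ^ 2 := by
  rw [← sq_abs]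
  exact pow_le_pow_left₀ (abs_nonneg _) (abs_norm_sub_norm_le u v) 2

/-- Splitting the coefficients into mean and half-difference separates what a lower bound on `φ`
controls from what its increments control. -/
lemma inner_radial_sub (a b : ℝ) (u v : V) :
    inner ℝ (a • u - b • v) (u - v) =
      (a + b) / 2 * ‖u - v‖ ^ 2 + (a - b) / 2 * (‖u‖ ^ 2 - ‖v‖ ^ 2) := by
  rw [norm_sub_sq_real]
  simp only [inner_sub_left, inner_sub_right, real_inner_smul_left, real_inner_self_eq_norm_sq,
    real_inner_comm u v]
  ring

/-- A lower bound `κ - C z^(-1/2)` for the derivative integrates to a lower bound for increments. -/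
lemma increment_lower_bound {φ : ℝ → ℝ} (hφ : ContDiffOn ℝ 1 φ (Ioi 0)) {κ C : ℝ}
    (h : ∀ z : ℝ, 0 < z → κ - C * z ^ (-(1 / 2) : ℝ) ≤ deriv φ z) {y z : ℝ} (hy : 0 < y)
    (hyz : y ≤ z) :
    κ * (z - y) - 2 * C * (√z - √y) ≤ φ z - φ y := by
  -- `2C√z` is a primitive of `C z^(-1/2)`, so the hypothesis on `φ'` says that this function is
  -- nondecreasing.
  have hd : ∀ x ∈ Ioi (0 : ℝ), HasDerivAt (fun z => φ z - κ * z + 2 * C * √z)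
      (deriv φ x - κ + 2 * C * (1 / (2 * √x))) x := by
    intro x hx
    have h1 : HasDerivAt φ (deriv φ x) x :=
      ((hφ.differentiableOn one_ne_zero).differentiableAt (Ioi_mem_nhds hx)).hasDerivAt
    have h2 := (hasDerivAt_id x).const_mul κ
    rw [mul_one] at h2
    have h3 := (Real.hasDerivAt_sqrt (ne_of_gt hx)).const_mul (2 * C)
    exact (h1.sub h2).add h3
  have hm : MonotoneOn (fun z => φ z - κ * z + 2 * C * √z) (Ioi 0) := by
    apply monotoneOn_of_deriv_nonneg (convex_Ioi 0)
    · exact fun x hx => (hd x hx).continuousAt.continuousWithinAt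
    · rw [interior_Ioi]; exact fun x hx => (hd x hx).differentiableAt.differentiableWithinAt
    · rw [interior_Ioi]
      intro x hx
      rw [(hd x hx).deriv]
      have h1 := h x hx
      have h2 : x ^ (-(1 / 2) : ℝ) = 1 / √x := by
        rw [Real.rpow_neg (le_of_lt hx), ← Real.sqrt_eq_rpow, one_div]
      rw [h2] at h1
      have h3 : 2 * C * (1 / (2 * √x)) = C * (1 / √x) := by
        have : √x ≠ 0 := (Real.sqrt_pos.2 hx).ne'
        field_simp
      linarith
  have := hm (mem_Ioi.2 hy) (mem_Ioi.2 (hy.trans_le hyz)) hyz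
  simp only at this
  linarith

/-- The nonlinearity is monotone up to a linear perturbation. -/
theorem IsNonlinearity.inner_sub_ge {l : ℝ} {f : V → V} (hf : IsNonlinearity l f) :
    ∃ K : ℝ, 0 < K ∧ ∀ u v : V, -K * ‖u - v‖ ^ 2 ≤ inner ℝ (f u - f v) (u - v) := by
  obtain ⟨-, φ, hφ, hfφ, α, κ, C, C₁, hα, hκ, hC, -, h⟩ := hf
  have hlow : ∀ z : ℝ, 0 < z → -C ≤ φ z := fun z hz =>
    le_trans (by have := Real.rpow_pos_of_pos hz l; nlinarith) (h z hz).2.1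
  -- `C` pays for the mean coefficient, since `φ ≥ -C`; `C²/(2κ)` is half the defect left by
  -- completing the square in `h7`.
  refine ⟨C + C ^ 2 / (2 * κ), by positivity, ?_⟩
  have hzero : ∀ u : V, u ≠ 0 → -(C + C ^ 2 / (2 * κ)) * ‖u‖ ^ 2 ≤ inner ℝ (f u) u := by
    intro u hu
    rw [hfφ, real_inner_smul_left, real_inner_self_eq_norm_sq]
    have h1 := hlow (‖u‖ ^ 2) (by positivity)
    have h2 : 0 ≤ C ^ 2 / (2 * κ) := by positivity
    nlinarith [sq_nonneg ‖u‖]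
  have hf0 : f 0 = 0 := by rw [hfφ, smul_zero]
  -- The bounds on `φ` hold only on `(0, ∞)`, so zero vectors are treated apart; the ordering of the
  -- norms is the one in which `φ'` is integrated.
  have main : ∀ u v : V, v ≠ 0 → ‖v‖ ≤ ‖u‖ →
      -(C + C ^ 2 / (2 * κ)) * ‖u - v‖ ^ 2 ≤ inner ℝ (f u - f v) (u - v) := by
    intro u v hv huv
    have hv' : 0 < ‖v‖ := norm_pos_iff.2 hv
    rw [hfφ u, hfφ v, inner_radial_sub]
    have h1 := increment_lower_bound hφ (fun z hz => (h z hz).1.1) (y := ‖v‖ ^ 2) (z := ‖u‖ ^ 2)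
      (by positivity) (by gcongr)
    rw [Real.sqrt_sq (norm_nonneg u), Real.sqrt_sq (norm_nonneg v)] at h1
    have h2 := hlow (‖v‖ ^ 2) (by positivity)
    have h3 := hlow (‖u‖ ^ 2) (by have := hv'.trans_le huv; positivity)
    have h4 : -C * ‖u - v‖ ^ 2 ≤ (φ (‖u‖ ^ 2) + φ (‖v‖ ^ 2)) / 2 * ‖u - v‖ ^ 2 := by
      gcongr; linarith
    have h5 : 0 ≤ ‖u‖ ^ 2 - ‖v‖ ^ 2 := by
      rw [sub_nonneg]; gcongr
    have h6 := mul_le_mul_of_nonneg_right h1 h5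
    have h7 : -(C ^ 2 / κ) * (‖u‖ - ‖v‖) ^ 2 ≤ (κ * (‖u‖ ^ 2 - ‖v‖ ^ 2) - 2 * C * (‖u‖ - ‖v‖)) *
        (‖u‖ ^ 2 - ‖v‖ ^ 2) := by
      -- With `m = ‖u‖ + ‖v‖`, this is `κm² - 2Cm + C²/κ = (κm - C)²/κ`, multiplied by `(‖u‖ -
      -- ‖v‖)²`.
      have : (κ * (‖u‖ ^ 2 - ‖v‖ ^ 2) - 2 * C * (‖u‖ - ‖v‖)) * (‖u‖ ^ 2 - ‖v‖ ^ 2)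
          - -(C ^ 2 / κ) * (‖u‖ - ‖v‖) ^ 2
          = (‖u‖ - ‖v‖) ^ 2 * ((κ * (‖u‖ + ‖v‖) - C) ^ 2 / κ) := by
        field_simp
        ring
      have h8 : 0 ≤ (‖u‖ - ‖v‖) ^ 2 * ((κ * (‖u‖ + ‖v‖) - C) ^ 2 / κ) := by positivity
      linarith
    have h9 : -(C ^ 2 / κ) * ‖u - v‖ ^ 2 ≤ -(C ^ 2 / κ) * (‖u‖ - ‖v‖) ^ 2 := by
      have : 0 ≤ C ^ 2 / κ := by positivity
      nlinarith [sq_norm_sub_norm_le u v]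
    have h10 : C ^ 2 / (2 * κ) = (C ^ 2 / κ) / 2 := by field_simp
    rw [h10]
    linarith
  intro u v
  rcases eq_or_ne v 0 with rfl | hv
  · rcases eq_or_ne u 0 with rfl | hu
    · simp
    · simpa [hf0] using hzero u hu
  rcases eq_or_ne u 0 with rfl | hu
  · have := hzero v hv
    simpa [hf0] using this
  rcases le_total ‖v‖ ‖u‖ with huv | huv
  · exact main u v hv huv
  · have := main v u hu huv
    rw [norm_sub_rev, ← neg_sub (f v) (f u), ← neg_sub v u, inner_neg_neg]
    exact this

/-- Polynomial growth of the nonlinearity. -/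
theorem IsNonlinearity.norm_le {l : ℝ} {f : V → V} (hf : IsNonlinearity l f) :
    ∃ C : ℝ, 0 < C ∧ ∀ u : V, ‖f u‖ ≤ C * (1 + ‖u‖ ^ (2 * l + 1)) := by
  obtain ⟨⟨hl, -⟩, φ, hφ, hfφ, α, κ, C, C₁, hα, hκ, hC, -, h⟩ := hf
  refine ⟨2 * C, by positivity, fun u => ?_⟩
  rcases eq_or_ne u 0 with rfl | hu
  · rw [hfφ]; simp only [smul_zero, norm_zero]; positivity
  have hu' : 0 < ‖u‖ := norm_pos_iff.2 hu
  have hz : 0 < ‖u‖ ^ 2 := by positivity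
  have h1 := (h _ hz).2
  have h2 : (‖u‖ ^ 2) ^ l * ‖u‖ = ‖u‖ ^ (2 * l + 1) := by
    rw [Real.rpow_add hu', Real.rpow_one, Real.rpow_mul hu'.le, Real.rpow_two]
  have h3 : |φ (‖u‖ ^ 2)| ≤ C * (1 + (‖u‖ ^ 2) ^ l) := by
    have := Real.rpow_pos_of_pos hz l
    rw [abs_le]; constructor <;> nlinarith
  have h4 : ‖u‖ ≤ 1 + ‖u‖ ^ (2 * l + 1) := by
    rcases le_total ‖u‖ 1 with h | h
    · have := Real.rpow_nonneg hu'.le (2 * l + 1); linarith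
    · have := Real.rpow_le_rpow_of_exponent_le h (show (1 : ℝ) ≤ 2 * l + 1 by linarith)
      rw [Real.rpow_one] at this; linarith
  rw [hfφ, norm_smul, Real.norm_eq_abs]
  calc _ ≤ C * (1 + (‖u‖ ^ 2) ^ l) * ‖u‖ := by gcongr
    _ = C * (‖u‖ + ‖u‖ ^ (2 * l + 1)) := by rw [← h2]; ring
    _ ≤ _ := by nlinarith

theorem IsNonlinearity.map_zero {l : ℝ} {f : V → V} (hf : IsNonlinearity l f) : f 0 = 0 := by
  obtain ⟨-, φ, -, hfφ, -⟩ := hf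
  rw [hfφ, smul_zero]

/-- Nothing is known about `φ 0`, but it only multiplies `u = 0`; hence `φ` may be cut off to `(0,
∞)`, where it is continuous. -/
theorem IsNonlinearity.measurable {l : ℝ} {f : V → V} (hf : IsNonlinearity l f) :
    Measurable f := by
  have h0 := hf.map_zero
  obtain ⟨-, φ, hφ, hfφ, -⟩ := hf
  have hm : Measurable ((Ioi (0 : ℝ)).indicator φ) := by
    rw [← Set.piecewise_eq_indicator]
    exact hφ.continuousOn.measurable_piecewise continuousOn_const measurableSet_Ioi
  have : f = fun u : V => (Ioi (0 : ℝ)).indicator φ (‖u‖ ^ 2) • u := by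
    funext u
    rcases eq_or_ne u 0 with rfl | hu
    · rw [h0, smul_zero]
    · rw [indicator_of_mem (show ‖u‖ ^ 2 ∈ Ioi (0 : ℝ) from pow_pos (norm_pos_iff.2 hu) 2), hfφ]
  rw [this]
  fun_prop

/-! ### Measurability and boundedness of curves in function spaces -/

/-- A strongly measurable family of `Lp` functions has a jointly measurable representative. -/
theorem exists_measurable_uncurry {S X F : Type*} [MeasurableSpace S] [MeasurableSpace X]
    {ν : Measure X} [NormedAddCommGroup F] [CompleteSpace F] [MeasurableSpace F] [BorelSpace F]
    [SecondCountableTopology F] {p : ENNReal} [Fact (1 ≤ p)] {v : S → Lp F p ν}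
    (hv : StronglyMeasurable v) :
    ∃ w : S × X → F, Measurable w ∧ ∀ t, (fun x => w (t, x)) =ᵐ[ν] v t := by
  classical
  rcases isEmpty_or_nonempty S with hS | ⟨⟨t₀⟩⟩
  · exact ⟨fun _ => 0, measurable_const, fun t => hS.elim t⟩
  obtain ⟨c, hc, hcv⟩ := hv.isSeparable_range
  have hcne : c.Nonempty := by
    by_contra h
    rw [not_nonempty_iff_eq_empty.1 h, closure_empty] at hcv
    exact hcv (mem_range_self t₀)
  obtain ⟨e, he⟩ := hc.exists_eq_range hcne
  -- The least index `j` that works is measurable in `t`, so the approximations `e (idx k t)` are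
  -- jointly measurable. Their errors are summable in `k`, which gives almost everywhere convergence
  -- for every `t`.
  have hex : ∀ (k : ℕ) (t : S), ∃ j, ‖e j - v t‖ < (1 / 4) ^ k := by
    intro k t
    obtain ⟨y, hy, hd⟩ := Metric.mem_closure_iff.1 (hcv (mem_range_self t)) ((1 / 4) ^ k)
      (by positivity)
    rw [he] at hy
    obtain ⟨j, rfl⟩ := hy
    exact ⟨j, by rwa [← dist_eq_norm, dist_comm]⟩
  let idx : ℕ → S → ℕ := fun k t => Nat.find (hex k t)
  have hidx : ∀ k t, ‖e (idx k t) - v t‖ < (1 / 4) ^ k := fun k t => Nat.find_spec (hex k t)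
  have hidxm : ∀ k, Measurable (idx k) := fun k => by
    refine measurable_find _ fun j => ?_
    have h1 : Measurable fun t => ‖e j - v t‖ :=
      ((stronglyMeasurable_const.sub hv).norm).measurable
    exact measurableSet_lt h1 measurable_const
  let g : ℕ × X → F := fun y => e y.1 y.2
  have hg : Measurable g := measurable_from_prod_countable_right fun j =>
    (Lp.stronglyMeasurable (e j)).measurable
  let z : ℕ → S × X → F := fun k y => e (idx k y.1) y.2
  have hz : ∀ k, Measurable (z k) := fun k =>
    hg.comp (((hidxm k).comp measurable_fst).prodMk measurable_snd)
  refine ⟨fun y => limUnder atTop fun k => z k y,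
    (StronglyMeasurable.limUnder fun k => (hz k).stronglyMeasurable).measurable, fun t => ?_⟩
  have hlim : ∀ᵐ x ∂ν, ∃ l, Tendsto (fun k => e (idx k t) x) atTop (𝓝 l) := by
    refine Lp.ae_tendsto_of_cauchy_eLpNorm (p := p) (fun k => (Lp.aestronglyMeasurable _))
      Fact.out (B := fun k => ENNReal.ofReal (2 * (1 / 4) ^ k)) ?_ ?_
    · have hs : Summable fun k : ℕ => 2 * (1 / 4 : ℝ) ^ k :=
        (summable_geometric_of_lt_one (by norm_num) (by norm_num)).mul_left 2
      rw [← ENNReal.ofReal_tsum_of_nonneg (fun k => by positivity) hs]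
      exact ENNReal.ofReal_ne_top
    · intro N n m hn hm
      rw [← eLpNorm_congr_ae (Lp.coeFn_sub _ _), ← Lp.enorm_def, ← ofReal_norm]
      rw [ENNReal.ofReal_lt_ofReal_iff (by positivity)]
      have h1 : ‖e (idx n t) - e (idx m t)‖ ≤ ‖e (idx n t) - v t‖ + ‖e (idx m t) - v t‖ := by
        have := norm_sub_le (e (idx n t) - v t) (e (idx m t) - v t)
        rwa [sub_sub_sub_cancel_right] at this
      have h2 : (1 / 4 : ℝ) ^ n ≤ (1 / 4) ^ N :=
        pow_le_pow_of_le_one (by norm_num) (by norm_num) hn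
      have h3 : (1 / 4 : ℝ) ^ m ≤ (1 / 4) ^ N :=
        pow_le_pow_of_le_one (by norm_num) (by norm_num) hm
      linarith [hidx n t, hidx m t]
  have hlp : Tendsto (fun k => e (idx k t)) atTop (𝓝 (v t)) := by
    rw [tendsto_iff_norm_sub_tendsto_zero]
    exact squeeze_zero (fun _ => norm_nonneg _) (fun k => (hidx k t).le)
      (tendsto_pow_atTop_nhds_zero_of_lt_one (by norm_num) (by norm_num))
  -- The almost everywhere limit is `v t`, because a subsequence of an `Lᵖ`-convergent sequence
  -- converges almost everywhere to the `Lᵖ` limit.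
  obtain ⟨ns, hns, hae⟩ := (tendstoInMeasure_of_tendsto_Lp hlp).exists_seq_tendsto_ae
  filter_upwards [hlim, hae] with x hx hx'
  obtain ⟨y, hy⟩ := hx
  rw [tendsto_nhds_unique hx' (hy.comp hns.tendsto_atTop)]
  exact hy.limUnder_eq

/-- A weakly continuous function with values in a separable Hilbert space is strongly
measurable. -/
theorem stronglyMeasurable_of_weakly_continuous {S H : Type*} [TopologicalSpace S]
    [MeasurableSpace S] [OpensMeasurableSpace S] [NormedAddCommGroup H] [InnerProductSpace ℝ H]
    [SecondCountableTopology H] {v : S → H} (hv : ∀ w, Continuous fun t => inner ℝ w (v t)) :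
    StronglyMeasurable v := by
  borelize H
  refine Measurable.stronglyMeasurable ?_
  have hball : ∀ c : H, ∀ r : ℝ, MeasurableSet (v ⁻¹' Metric.closedBall c r) := by
    intro c r
    rcases lt_or_ge r 0 with hr | hr
    · simp [Metric.closedBall_eq_empty.2 hr]
    -- A closed ball is an intersection of closed half-spaces, whose preimages under a weakly
    -- continuous map are closed; the choice `w = v t - c` recovers the norm.
    have : v ⁻¹' Metric.closedBall c r = ⋂ w : H, {t | inner ℝ w (v t) - inner ℝ w c ≤ ‖w‖ * r} := by
      ext t
      simp only [mem_preimage, Metric.mem_closedBall, mem_iInter, mem_ofPred_eq, dist_eq_norm,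
        ← inner_sub_right]
      constructor
      · intro h w
        exact (real_inner_le_norm _ _).trans (by gcongr)
      · intro h
        have h1 := h (v t - c)
        rw [real_inner_self_eq_norm_mul_norm] at h1
        rcases (norm_nonneg (v t - c)).eq_or_lt with h2 | h2
        · rwa [← h2]
        · exact le_of_mul_le_mul_left h1 h2
    rw [this]
    exact (isClosed_iInter fun w =>
      isClosed_le ((hv w).sub continuous_const) continuous_const).measurableSet
  refine measurable_of_isOpen fun U hU => ?_
  let d := TopologicalSpace.denseSeq H
  have hd := TopologicalSpace.denseRange_denseSeq H
  have hU'' : U = ⋃ (i : ℕ) (r : ℚ) (_ : Metric.closedBall (d i) (r : ℝ) ⊆ U),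
      Metric.closedBall (d i) (r : ℝ) := by
    ext x
    simp only [mem_iUnion]
    constructor
    · intro hx
      obtain ⟨ε, hε, h⟩ := Metric.nhds_basis_closedBall.mem_iff.1 (hU.mem_nhds hx)
      obtain ⟨r, hr0, hr⟩ := exists_rat_btwn (show (0 : ℝ) < ε / 2 by positivity)
      obtain ⟨i, hi⟩ := hd.exists_dist_lt x hr0
      refine ⟨i, r, fun y hy => h ?_, Metric.mem_closedBall.2 hi.le⟩
      rw [Metric.mem_closedBall] at hy ⊢
      linarith [dist_triangle y (d i) x, dist_comm x (d i)]
    · rintro ⟨i, r, h, hx⟩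
      exact h hx
  rw [hU'']
  simp only [preimage_iUnion]
  exact MeasurableSet.iUnion fun i => MeasurableSet.iUnion fun r => MeasurableSet.iUnion fun _ =>
    hball _ _

/-- A weakly continuous function on a compact set is bounded. -/
theorem exists_norm_le_of_weakly_continuousOn {S H : Type*} [TopologicalSpace S]
    [NormedAddCommGroup H] [InnerProductSpace ℝ H] [CompleteSpace H] {s : Set S}
    (hs : IsCompact s) {v : S → H} (hv : ∀ w, ContinuousOn (fun t => inner ℝ w (v t)) s) :
    ∃ M : ℝ, ∀ t ∈ s, ‖v t‖ ≤ M := by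
  have := banach_steinhaus (g := fun t : s => innerSL ℝ (v t)) fun w => by
    obtain ⟨M, hM⟩ := hs.exists_bound_of_continuousOn (hv w)
    exact ⟨M, fun t => by
      rw [innerSL_apply_apply, real_inner_comm]; exact hM t t.2⟩
  obtain ⟨M, hM⟩ := this
  exact ⟨M, fun t ht => by simpa using hM ⟨t, ht⟩⟩

/-! ### Hölder pairings and their limits -/

section Pairing

variable {X F : Type*} [MeasurableSpace X] {μ : Measure X} [NormedAddCommGroup F]
  [InnerProductSpace ℝ F] {p q : ENNReal}

/-- Hölder's inequality for the inner product. -/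
lemma eLpNorm_inner_le [ENNReal.HolderTriple p q 1] {a b : X → F}
    (ha : AEStronglyMeasurable a μ) (hb : AEStronglyMeasurable b μ) :
    eLpNorm (fun x => inner ℝ (a x) (b x)) 1 μ ≤ eLpNorm a p μ * eLpNorm b q μ := by
  simpa using eLpNorm_le_eLpNorm_mul_eLpNorm_of_nnnorm (r := 1) ha hb (fun u v => inner ℝ u v) 1
    (.of_forall fun x => by simpa using nnnorm_inner_le_nnnorm (𝕜 := ℝ) (a x) (b x))

lemma integrable_inner_of_memLp [ENNReal.HolderTriple p q 1] {a b : X → F} (ha : MemLp a p μ)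
    (hb : MemLp b q μ) : Integrable (fun x => inner ℝ (a x) (b x)) μ := by
  rw [← memLp_one_iff_integrable]
  exact ⟨ha.1.inner hb.1, (eLpNorm_inner_le ha.1 hb.1).trans_lt (ENNReal.mul_lt_top ha.2 hb.2)⟩

lemma integral_norm_inner_le [ENNReal.HolderTriple p q 1] {a b : X → F} (ha : MemLp a p μ)
    (hb : MemLp b q μ) :
    ∫ x, ‖inner ℝ (a x) (b x)‖ ∂μ ≤ (eLpNorm a p μ).toReal * (eLpNorm b q μ).toReal := by
  rw [← ENNReal.toReal_mul, integral_norm_eq_lintegral_enorm (ha.1.inner hb.1),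
    ← eLpNorm_one_eq_lintegral_enorm]
  exact ENNReal.toReal_mono (ENNReal.mul_lt_top ha.2 hb.2).ne (eLpNorm_inner_le ha.1 hb.1)

lemma tendsto_integral_inner_left [ENNReal.HolderTriple p q 1] {ι : Type*} {L : Filter ι}
    {a : ι → X → F} {a₀ b : X → F} (ha : ∀ i, MemLp (a i) p μ) (ha₀ : MemLp a₀ p μ)
    (hb : MemLp b q μ) (h : Tendsto (fun i => eLpNorm (fun x => a i x - a₀ x) p μ) L (𝓝 0)) :
    Tendsto (fun i => ∫ x, inner ℝ (a i x) (b x) ∂μ) L (𝓝 (∫ x, inner ℝ (a₀ x) (b x) ∂μ)) := by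
  rw [tendsto_iff_norm_sub_tendsto_zero]
  have h1 : Tendsto (fun i => (eLpNorm (fun x => a i x - a₀ x) p μ).toReal *
      (eLpNorm b q μ).toReal) L (𝓝 0) := by
    have := ((ENNReal.tendsto_toReal ENNReal.zero_ne_top).comp h).mul_const (eLpNorm b q μ).toReal
    simpa using this
  refine squeeze_zero (fun _ => norm_nonneg _) (fun i => ?_) h1
  rw [← integral_sub (integrable_inner_of_memLp (ha i) hb) (integrable_inner_of_memLp ha₀ hb)]
  simp_rw [← inner_sub_left]
  exact (norm_integral_le_integral_norm _).trans (integral_norm_inner_le ((ha i).sub ha₀) hb)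

lemma tendsto_integral_inner_right [ENNReal.HolderTriple p q 1] {ι : Type*} {L : Filter ι}
    {a : X → F} {b : ι → X → F} {b₀ : X → F} (ha : MemLp a p μ) (hb : ∀ i, MemLp (b i) q μ)
    (hb₀ : MemLp b₀ q μ) (h : Tendsto (fun i => eLpNorm (fun x => b i x - b₀ x) q μ) L (𝓝 0)) :
    Tendsto (fun i => ∫ x, inner ℝ (a x) (b i x) ∂μ) L (𝓝 (∫ x, inner ℝ (a x) (b₀ x) ∂μ)) := by
  have : ENNReal.HolderTriple q p 1 := ENNReal.HolderTriple.symm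
  simpa only [real_inner_comm] using tendsto_integral_inner_left hb hb₀ ha h

end Pairing

/-! ### Time translations and shift-continuous kernels -/

section Translation

variable {F : Type*} [NormedAddCommGroup F] {p q : ENNReal}

lemma measurePreserving_sub_fst (θ : ℝ) :
    MeasurePreserving (fun z : ℝ × V => (z.1 - θ, z.2)) := by
  exact (measurePreserving_sub_right (volume : Measure ℝ) θ).prod
    (MeasurePreserving.id (volume : Measure V))

/-- Translations in time are continuous in `Lᵖ`. -/
lemma tendsto_eLpNorm_translate [Fact (1 ≤ p)] (hp : p ≠ ⊤) {a : ℝ × V → F}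
    (ha : MemLp a p) :
    Tendsto (fun θ : ℝ => eLpNorm (fun z : ℝ × V => a (z.1 - θ, z.2) - a z) p) (𝓝 0) (𝓝 0) := by
  -- Time shifts depend continuously on `θ` in the compact-open topology, which is what continuity
  -- of composition in `Lᵖ` requires.
  let g : C(ℝ, C(ℝ × V, ℝ × V)) :=
    (ContinuousMap.mk (fun y : ℝ × (ℝ × V) => (y.2.1 - y.1, y.2.2)) (by fun_prop)).curry
  have hg : Tendsto (fun θ => g θ) (𝓝 0) (𝓝 (g 0)) := g.continuous.tendsto 0
  have h := (tendsto_const_nhds (x := ha.toLp a)).compMeasurePreservingLp hg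
    (fun θ => measurePreserving_sub_fst θ) (measurePreserving_sub_fst 0) hp
  rw [Lp.tendsto_Lp_iff_tendsto_eLpNorm'] at h
  refine h.congr fun θ => eLpNorm_congr_ae ?_
  have h1 := Lp.coeFn_compMeasurePreserving (ha.toLp a) (measurePreserving_sub_fst θ)
  have h2 := Lp.coeFn_compMeasurePreserving (ha.toLp a) (measurePreserving_sub_fst 0)
  have h3 := (measurePreserving_sub_fst θ).quasiMeasurePreserving.ae_eq_comp ha.coeFn_toLp
  have h4 := (measurePreserving_sub_fst 0).quasiMeasurePreserving.ae_eq_comp ha.coeFn_toLp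
  filter_upwards [h1, h2, h3, h4] with z h1 h2 h3 h4
  simp only [Pi.sub_apply]
  erw [h1, h2, h3, h4]
  simp

end Translation

/-- A kernel `B(σ, r)` that can be integrated along the shifted diagonals `σ = r - θ`,
continuously at `θ = 0`. -/
structure ShiftContinuous (c : ℝ) (B : ℝ → ℝ → ℝ) : Prop where
  integrableOn : ∀ θ, IntegrableOn (fun r => B (r - θ) r) (Ioc 0 c)
  integrable_prod : ∀ δ : ℝ, Integrable (fun y : ℝ × ℝ => B (y.2 - y.1) y.2)
    ((volume.restrict (Ioc 0 δ)).prod (volume.restrict (Ioc 0 c)))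
  tendsto : Tendsto (fun θ => ∫ r in Ioc 0 c, B (r - θ) r) (𝓝 0) (𝓝 (∫ r in Ioc 0 c, B r r))

lemma ShiftContinuous.add {c : ℝ} {B₁ B₂ : ℝ → ℝ → ℝ} (h₁ : ShiftContinuous c B₁)
    (h₂ : ShiftContinuous c B₂) : ShiftContinuous c (fun σ r => B₁ σ r + B₂ σ r) where
  integrableOn θ := (h₁.integrableOn θ).add (h₂.integrableOn θ)
  integrable_prod δ := (h₁.integrable_prod δ).add (h₂.integrable_prod δ)
  tendsto := by
    have h := h₁.tendsto.add h₂.tendsto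
    have e₁ := h₁.integrableOn 0
    have e₂ := h₂.integrableOn 0
    simp only [sub_zero] at e₁ e₂
    rw [← integral_add e₁ e₂] at h
    refine h.congr fun θ => ?_
    rw [← integral_add (h₁.integrableOn θ) (h₂.integrableOn θ)]

lemma ShiftContinuous.sum {c : ℝ} {ι : Type*} {s : Finset ι} {B : ι → ℝ → ℝ → ℝ}
    (h : ∀ i ∈ s, ShiftContinuous c (B i)) : ShiftContinuous c (fun σ r => ∑ i ∈ s, B i σ r) := by
  classical
  induction s using Finset.induction_on with
  | empty => exact ⟨by simp, by simp, by simp⟩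
  | insert i s hi ih =>
    simp only [Finset.sum_insert hi]
    exact (h i (by simp)).add (ih fun j hj => h j (by simp [hj]))

/-- Kernels given by `Lᵖ`-`Lᵠ` duality in space are shift continuous. -/
theorem shiftContinuous_integral_inner {F : Type*} [NormedAddCommGroup F] [InnerProductSpace ℝ F]
    [MeasurableSpace F] [BorelSpace F] [SecondCountableTopology F] {p q : ENNReal}
    [ENNReal.HolderTriple p q 1] [Fact (1 ≤ p)] (hp : p ≠ ⊤) {a b : ℝ × V → F}
    (ham : Measurable a) (hbm : Measurable b) (ha : MemLp a p) (hb : MemLp b q) (c : ℝ) :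
    ShiftContinuous c (fun σ r => ∫ x, inner ℝ (a (σ, x)) (b (r, x))) := by
  let μ : Measure (ℝ × V) := (volume.restrict (Ioc 0 c)).prod volume
  have hμ : μ ≤ volume := by
    rw [Measure.volume_eq_prod]
    exact Measure.prod_mono Measure.restrict_le_self le_rfl
  have hbμ : MemLp b q μ := hb.mono_measure hμ
  have haθ : ∀ θ : ℝ, MemLp (fun z : ℝ × V => a (z.1 - θ, z.2)) p := fun θ =>
    ha.comp_measurePreserving (measurePreserving_sub_fst θ)
  have haθn : ∀ θ : ℝ, eLpNorm (fun z : ℝ × V => a (z.1 - θ, z.2)) p = eLpNorm a p := fun θ =>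
    eLpNorm_comp_measurePreserving ha.1 (measurePreserving_sub_fst θ)
  have hi : ∀ θ : ℝ, Integrable (fun z : ℝ × V => inner ℝ (a (z.1 - θ, z.2)) (b z)) μ :=
    fun θ => integrable_inner_of_memLp ((haθ θ).mono_measure hμ) hbμ
  refine ⟨fun θ => (hi θ).integral_prod_left, fun δ => ?_, ?_⟩
  · have hm : Measurable (fun y : ℝ × (ℝ × V) => inner ℝ (a (y.2.1 - y.1, y.2.2)) (b y.2)) := by
      fun_prop
    have h1 : Integrable (fun y : ℝ × (ℝ × V) => inner ℝ (a (y.2.1 - y.1, y.2.2)) (b y.2))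
        ((volume.restrict (Ioc 0 δ)).prod μ) := by
      rw [integrable_prod_iff hm.aestronglyMeasurable]
      refine ⟨.of_forall hi, ?_⟩
      -- Translations preserve the `Lᵖ` norm, so Hölder's bound is uniform in `θ`.
      refine Integrable.mono' (integrable_const ((eLpNorm a p).toReal * (eLpNorm b q μ).toReal))
        (hm.stronglyMeasurable.norm.integral_prod_right).aestronglyMeasurable
        (.of_forall fun θ => ?_)
      rw [Real.norm_of_nonneg (by positivity)]
      refine (integral_norm_inner_le ((haθ θ).mono_measure hμ) hbμ).trans ?_
      gcongr
      · exact ha.2.ne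
      · rw [← haθn θ]; exact eLpNorm_mono_measure _ hμ
    have h2 := (measurePreserving_prodAssoc (volume.restrict (Ioc 0 δ))
      (volume.restrict (Ioc 0 c)) (volume : Measure V)).integrable_comp_emb
        MeasurableEquiv.prodAssoc.measurableEmbedding |>.2 h1
    exact h2.integral_prod_left
  · have h := tendsto_integral_inner_left (μ := μ) (fun θ => (haθ θ).mono_measure hμ)
      (ha.mono_measure hμ) hbμ (tendsto_of_tendsto_of_tendsto_of_le_of_le tendsto_const_nhds
        (tendsto_eLpNorm_translate hp ha) (fun _ => zero_le) fun θ => eLpNorm_mono_measure _ hμ)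
    have h0 := hi 0
    simp only [sub_zero] at h0
    rw [integral_prod _ h0] at h
    refine h.congr fun θ => ?_
    rw [integral_prod _ (hi θ)]

/-! ### The abstract energy inequality and Gronwall's lemma -/

/-- **Energy inequality** for a weakly continuous curve whose increments are given by a kernel. -/
theorem energy_inequality {H : Type*} [NormedAddCommGroup H] [InnerProductSpace ℝ H] {W : ℝ → H}
    (hW : ∀ v, Continuous fun t => inner ℝ v (W t)) (hWm : Measurable fun t => ‖W t‖)
    (hWb : ∃ M, ∀ t, ‖W t‖ ≤ M) (hneg : ∀ t ≤ 0, W t = W 0) {c : ℝ} (hc : 0 < c)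
    {B : ℝ → ℝ → ℝ} (hB : ShiftContinuous c B)
    (hid : ∀ᵐ r ∂(volume.restrict (Ioc 0 c)), ∀ s ≤ r,
      inner ℝ (W r - W s) (W r) = ∫ σ in s..r, B σ r) :
    ‖W c‖ ^ 2 ≤ ‖W 0‖ ^ 2 + 2 * ∫ r in Ioc 0 c, B r r := by
  obtain ⟨M, hM⟩ := hWb
  have hyi : ∀ s t : ℝ, IntervalIntegrable (fun r => ‖W r‖ ^ 2) volume s t := by
    intro s t
    refine (intervalIntegrable_const (c := M ^ 2)).mono_fun (hWm.pow_const 2).aestronglyMeasurable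
      (.of_forall fun r => ?_)
    simp only [norm_pow, norm_norm]
    exact pow_le_pow_left₀ (norm_nonneg _) ((hM r).trans (le_abs_self M)) 2
  -- In the integral of `‖W(r)‖² - ‖W(r-δ)‖²` over `(0, c)` all cancels except two layers of width
  -- `δ`; on the lower one, at negative times, `W` is constantly `W 0`.
  have key : ∀ δ : ℝ, 0 < δ →
      (∫ r in (c - δ)..c, ‖W r‖ ^ 2) ≤
        δ * ‖W 0‖ ^ 2 + 2 * ∫ θ in Ioc 0 δ, ∫ r in Ioc 0 c, B (r - θ) r := by
    intro δ hδ
    have e1 : ∫ r in (0 : ℝ)..c, ‖W (r - δ)‖ ^ 2 = ∫ r in (-δ)..(c - δ), ‖W r‖ ^ 2 := by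
      rw [intervalIntegral.integral_comp_sub_right (fun r => ‖W r‖ ^ 2) δ, zero_sub]
    have e2 : ∫ r in (-δ)..0, ‖W r‖ ^ 2 = δ * ‖W 0‖ ^ 2 := by
      rw [intervalIntegral.integral_congr (g := fun _ => ‖W 0‖ ^ 2)]
      · simp
      · intro r hr
        rw [uIcc_of_le (by linarith)] at hr
        simp only [hneg r hr.2]
    have e3 := intervalIntegral.integral_add_adjacent_intervals (hyi (-δ) 0) (hyi 0 (c - δ))
    have e4 := intervalIntegral.integral_add_adjacent_intervals (hyi 0 (c - δ)) (hyi (c - δ) c)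
    have hshift : IntervalIntegrable (fun r => ‖W (r - δ)‖ ^ 2) volume 0 c := by
      simpa using (hyi (0 - δ) (c - δ)).comp_sub_right δ
    have e5 : ∫ r in (0 : ℝ)..c, (‖W r‖ ^ 2 - ‖W (r - δ)‖ ^ 2) ≤
        2 * ∫ θ in Ioc 0 δ, ∫ r in Ioc 0 c, B (r - θ) r := by
      have hint := (hB.integrable_prod δ)
      have hsw := integral_integral_swap (f := fun θ r => B (r - θ) r) hint
      rw [hsw, ← integral_const_mul, intervalIntegral.integral_of_le hc.le]
      refine integral_mono_ae ((hyi 0 c).sub hshift).1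
        ((hint.swap.integral_prod_left).const_mul 2) ?_
      filter_upwards [hid] with r hr
      have h1 := hr (r - δ) (by linarith)
      have h2 : ∫ σ in (r - δ)..r, B σ r = ∫ θ in Ioc 0 δ, B (r - θ) r := by
        rw [← intervalIntegral.integral_of_le hδ.le,
          intervalIntegral.integral_comp_sub_left (fun σ => B σ r) r, sub_zero]
      rw [h2] at h1
      rw [← h1, inner_sub_left, real_inner_self_eq_norm_sq]
      -- Expanding this square yields `‖a‖² - ‖b‖² ≤ 2⟨a - b, a⟩`.
      have h3 := sq_nonneg ‖W r - W (r - δ)‖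
      have h4 := norm_sub_sq_real (W r) (W (r - δ))
      have h5 := sq_nonneg (‖W r - W (r - δ)‖)
      rw [real_inner_comm] at h4
      nlinarith
    rw [intervalIntegral.integral_sub (hyi 0 c) hshift] at e5
    linarith
  by_contra hcon
  rw [not_le] at hcon
  set P := ∫ r in Ioc 0 c, B r r with hP
  -- The errors in `k1` and `k2` add up to `4ε`, half of the assumed gap `8ε`, which gives the
  -- contradiction.
  set ε := (‖W c‖ ^ 2 - ‖W 0‖ ^ 2 - 2 * P) / 8 with hε
  have hεpos : 0 < ε := by rw [hε]; linarith
  have hPlim := hB.tendsto.eventually (gt_mem_nhds (show P < P + ε by linarith))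
  have hWlim := (hW (W c)).continuousAt (x := c) |>.eventually
    (lt_mem_nhds (show ‖W c‖ ^ 2 - ε < inner ℝ (W c) (W c) by
      rw [real_inner_self_eq_norm_sq]; linarith))
  obtain ⟨δ₁, hδ₁, h₁⟩ := Metric.eventually_nhds_iff.1 hPlim
  obtain ⟨δ₂, hδ₂, h₂⟩ := Metric.eventually_nhds_iff.1 hWlim
  set δ := min δ₁ δ₂ / 2 with hδdef
  have hδ : 0 < δ := by positivity
  have hδ1 : δ < δ₁ := by have := min_le_left δ₁ δ₂; linarith
  have hδ2 : δ < δ₂ := by have := min_le_right δ₁ δ₂; linarith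
  -- Quantitative weak lower semicontinuity: `‖W r‖² ≥ 2⟨W c, W r⟩ - ‖W c‖²`, and the inner product
  -- exceeds `‖W c‖² - ε` for `r` near `c`.
  have k1 : δ * (‖W c‖ ^ 2 - 2 * ε) ≤ ∫ r in (c - δ)..c, ‖W r‖ ^ 2 := by
    have : δ * (‖W c‖ ^ 2 - 2 * ε) = ∫ r in (c - δ)..c, (‖W c‖ ^ 2 - 2 * ε) := by
      simp; ring
    rw [this]
    refine intervalIntegral.integral_mono_on (by linarith) intervalIntegrable_const (hyi _ _) ?_
    intro r hr
    have h3 := h₂ (y := r) (by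
      rw [Real.dist_eq, abs_lt]; constructor <;> linarith [hr.1, hr.2])
    have h4 := norm_sub_sq_real (W c) (W r)
    nlinarith [sq_nonneg ‖W c - W r‖]
  have k2 : ∫ θ in Ioc 0 δ, ∫ r in Ioc 0 c, B (r - θ) r ≤ δ * (P + ε) := by
    have : δ * (P + ε) = ∫ θ in Ioc 0 δ, (P + ε) := by simp [hδ.le]
    rw [this]
    refine setIntegral_mono_on (hB.integrable_prod δ).integral_prod_left
      (integrable_const _) measurableSet_Ioc ?_
    intro θ hθ
    refine (h₁ (y := θ) ?_).le
    rw [Real.dist_eq, sub_zero, abs_of_pos hθ.1]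
    linarith [hθ.2]
  have k3 := key δ hδ
  have k4 : δ * (‖W c‖ ^ 2 - 2 * ε) ≤ δ * (‖W 0‖ ^ 2 + 2 * (P + ε)) := by linarith
  have k5 := le_of_mul_le_mul_left k4 hδ
  linarith

/-- A Gronwall inequality for bounded measurable functions. -/
theorem le_two_mul_exp_of_integral_le {y : ℝ → ℝ} {T K M : ℝ} (hK : 0 < K) (hT : 0 ≤ T)
    (hym : Measurable y) (hy0 : ∀ t, 0 ≤ y t) (hyM : ∀ t, y t ≤ M)
    (h : ∀ c ∈ Ioc 0 T, y c ≤ y 0 + K * ∫ r in Ioc 0 c, y r) :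
    ∀ t ∈ Icc 0 T, y t ≤ 2 * Real.exp (2 * K * t) * y 0 := by
  have hyi : ∀ c : ℝ, IntegrableOn y (Ioc 0 c) := fun c =>
    Integrable.mono' (integrable_const M) hym.aestronglyMeasurable
      (.of_forall fun t => by rw [Real.norm_of_nonneg (hy0 t)]; exact hyM t)
  -- A weight with twice the rate `K` makes the integral term contribute at most `A / 2`, so `A ≤ y
  -- 0 + A / 2`. The factor `2` in the conclusion comes from here, and no continuity of `y` is
  -- needed.
  let A := sSup ((fun t => y t * Real.exp (-(2 * K * t))) '' Icc 0 T)
  have hbdd : BddAbove ((fun t => y t * Real.exp (-(2 * K * t))) '' Icc 0 T) := by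
    refine ⟨M, ?_⟩
    rintro _ ⟨t, ht, rfl⟩
    have h1 : Real.exp (-(2 * K * t)) ≤ 1 := Real.exp_le_one_iff.2 (by
      have := ht.1; have : 0 ≤ 2 * K * t := by positivity
      linarith)
    calc y t * Real.exp (-(2 * K * t)) ≤ y t * 1 := by gcongr; exact hy0 t
      _ ≤ M := by rw [mul_one]; exact hyM t
  have hA : ∀ t ∈ Icc 0 T, y t ≤ A * Real.exp (2 * K * t) := by
    intro t ht
    have h1 : y t * Real.exp (-(2 * K * t)) ≤ A := le_csSup hbdd ⟨t, ht, rfl⟩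
    calc y t = y t * Real.exp (-(2 * K * t)) * Real.exp (2 * K * t) := by
          rw [mul_assoc, ← Real.exp_add]; simp
      _ ≤ _ := by gcongr
  have hA0 : 0 ≤ A := by
    have := hA 0 ⟨le_rfl, hT⟩
    simp only [mul_zero, Real.exp_zero, mul_one] at this
    exact (hy0 0).trans this
  have step : ∀ t ∈ Icc 0 T, y t ≤ (y 0 + A / 2) * Real.exp (2 * K * t) := by
    intro t ht
    have he : 1 ≤ Real.exp (2 * K * t) := Real.one_le_exp (by have := ht.1; positivity)
    rcases ht.1.eq_or_lt with rfl | ht0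
    · simp only [mul_zero, Real.exp_zero, mul_one]; linarith
    have h1 := h t ⟨ht0, ht.2⟩
    have h2 : ∫ r in Ioc 0 t, y r ≤ ∫ r in Ioc 0 t, A * Real.exp (2 * K * r) := by
      refine setIntegral_mono_on (hyi t) ?_ measurableSet_Ioc fun r hr =>
        hA r ⟨hr.1.le, hr.2.trans ht.2⟩
      exact (Continuous.integrableOn_Ioc (by fun_prop))
    have h3 : ∫ r in Ioc 0 t, A * Real.exp (2 * K * r) =
        A * ((Real.exp (2 * K * t) - 1) / (2 * K)) := by
      rw [integral_const_mul, ← intervalIntegral.integral_of_le ht0.le,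
        intervalIntegral.integral_comp_mul_left (fun x => Real.exp x) (by positivity), integral_exp]
      simp only [mul_zero, Real.exp_zero, smul_eq_mul]
      field_simp
    have h4 : K * (A * ((Real.exp (2 * K * t) - 1) / (2 * K))) =
        A / 2 * (Real.exp (2 * K * t) - 1) := by field_simp
    have h5 : y t ≤ y 0 + A / 2 * (Real.exp (2 * K * t) - 1) := by
      rw [← h4, ← h3]; exact h1.trans (by gcongr)
    have h6 := hy0 0
    nlinarith
  have hAle : A ≤ y 0 + A / 2 := by
    refine csSup_le ⟨_, 0, ⟨le_rfl, hT⟩, rfl⟩ ?_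
    rintro _ ⟨t, ht, rfl⟩
    calc y t * Real.exp (-(2 * K * t)) ≤
        (y 0 + A / 2) * Real.exp (2 * K * t) * Real.exp (-(2 * K * t)) := by
          gcongr; exact step t ht
      _ = _ := by rw [mul_assoc, ← Real.exp_add]; simp
  intro t ht
  calc y t ≤ A * Real.exp (2 * K * t) := hA t ht
    _ ≤ (2 * y 0) * Real.exp (2 * K * t) := by gcongr; linarith
    _ = _ := by ring

/-! ### The space `H¹₀`: Sobolev embedding and integration by parts -/

/-- The `i`-th vector of the standard basis of `V`. -/
abbrev e (i : Fin 3) : V := EuclideanSpace.single i 1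

/-- Pairs `(φ, ∇φ)` with `φ` a smooth field compactly supported in `Ω`. -/
def testGraph (Ω : Set V) : Set (L2 Ω V × (Fin 3 → L2 Ω V)) :=
  {vw | ∃ φ : V → V, ContDiff ℝ ∞ φ ∧ HasCompactSupport φ ∧ tsupport φ ⊆ Ω ∧
    vw.1 =ᵐ[volume.restrict Ω] φ ∧
    ∀ i, vw.2 i =ᵐ[volume.restrict Ω] fun x => fderiv ℝ φ x (e i)}

lemma sub_mem_testGraph {Ω : Set V} {x y : L2 Ω V × (Fin 3 → L2 Ω V)} (hx : x ∈ testGraph Ω)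
    (hy : y ∈ testGraph Ω) : x - y ∈ testGraph Ω := by
  obtain ⟨φ, h1, h2, h3, h4, h5⟩ := hx
  obtain ⟨ψ, k1, k2, k3, k4, k5⟩ := hy
  refine ⟨φ - ψ, h1.sub k1, h2.sub k2, (tsupport_sub φ ψ).trans (union_subset h3 k3), ?_, ?_⟩
  · exact (Lp.coeFn_sub x.1 y.1).trans (h4.sub k4)
  · intro i
    refine (Lp.coeFn_sub (x.2 i) (y.2 i)).trans (((h5 i).sub (k5 i)).trans (.of_forall fun z => ?_))
    have hφ : DifferentiableAt ℝ φ z := h1.differentiable (by simp) z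
    have hψ : DifferentiableAt ℝ ψ z := k1.differentiable (by simp) z
    simp [fderiv_sub hφ hψ]

lemma sub_mem_H10Graph {Ω : Set V} {x y : L2 Ω V × (Fin 3 → L2 Ω V)} (hx : x ∈ H10Graph Ω)
    (hy : y ∈ H10Graph Ω) : x - y ∈ H10Graph Ω :=
  map_mem_closure₂ continuous_sub hx hy fun _ ha _ hb => sub_mem_testGraph ha hb

lemma norm_le_sum_norm_apply (A : V →L[ℝ] V) : ‖A‖ ≤ ∑ i, ‖A (e i)‖ := by
  refine A.opNorm_le_bound (by positivity) fun x => ?_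
  have hx : x = ∑ i, x i • e i := by
    ext j
    simp [Finset.sum_apply, Pi.single_apply]
  calc ‖A x‖ = ‖∑ i, x i • A (e i)‖ := by conv_lhs => rw [hx, map_sum]; simp only [map_smul]
    _ ≤ ∑ i, ‖x i • A (e i)‖ := norm_sum_le _ _
    _ ≤ ∑ i, ‖A (e i)‖ * ‖x‖ := by
      refine Finset.sum_le_sum fun i _ => ?_
      rw [norm_smul, mul_comm]
      gcongr
      exact PiLp.norm_apply_le x i
    _ = _ := by rw [Finset.sum_mul]

lemma eLpNorm_fderiv_eq_restrict {Ω : Set V} {φ : V → V} (h : tsupport φ ⊆ Ω) (p : ENNReal) :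
    eLpNorm (fderiv ℝ φ) p volume = eLpNorm (fderiv ℝ φ) p (volume.restrict Ω) := by
  have hsupp : Function.support (fun x => ‖fderiv ℝ φ x‖) ⊆ Ω := fun x hx =>
    h (support_fderiv_subset ℝ (by simpa using hx))
  rw [← eLpNorm_norm (fderiv ℝ φ), ← eLpNorm_norm (fderiv ℝ φ),
    eLpNorm_restrict_eq_of_support_subset hsupp]

/-- The Sobolev embedding `H¹₀(Ω) ⊂ L^q(Ω)`, `q ≤ 6`. -/
theorem exists_eLpNorm_le_of_mem_H10Graph {Ω : Set V} (hΩ : Bornology.IsBounded Ω) {q : NNReal}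
    (hq0 : 0 < q) (hq : q ≤ 6) :
    ∃ C : NNReal, ∀ x ∈ H10Graph Ω, eLpNorm x.1 q (volume.restrict Ω) ≤ C * ‖x.2‖ₑ := by
  let C₀ := MeasureTheory.eLpNormLESNormFDerivOfLeConst V (volume : Measure V) Ω 2 q
  have htest : ∀ x ∈ testGraph Ω, eLpNorm x.1 q (volume.restrict Ω) ≤ (C₀ * 3 : NNReal) * ‖x.2‖ₑ := by
    rintro ⟨v, G⟩ ⟨φ, h1, h2, h3, h4, h5⟩
    -- In dimension three the condition `1/2 - 1/3 ≤ 1/q` reads `q ≤ 6`.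
    have hpq : ((2 : NNReal) : ℝ)⁻¹ - (Module.finrank ℝ V : ℝ)⁻¹ ≤ (q : ℝ)⁻¹ := by
      have : (6 : ℝ)⁻¹ ≤ (q : ℝ)⁻¹ := inv_anti₀ (by exact_mod_cast hq0) (by exact_mod_cast hq)
      simp only [finrank_euclideanSpace, Fintype.card_fin]
      norm_num at this ⊢
      exact this
    have k1 := eLpNorm_le_eLpNorm_fderiv_of_le (volume : Measure V)
      (h1.of_le (by exact_mod_cast le_top)) ((subset_tsupport φ).trans h3) (p := 2) (q := q)
      (by norm_num) (by simp; norm_num) hpq hΩ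
    have k2 : eLpNorm (fderiv ℝ φ) 2 volume ≤ ∑ i, ‖G i‖ₑ := by
      rw [eLpNorm_fderiv_eq_restrict h3]
      calc eLpNorm (fderiv ℝ φ) 2 (volume.restrict Ω)
          ≤ eLpNorm (∑ i, fun x => ‖G i x‖) 2 (volume.restrict Ω) := by
            refine eLpNorm_mono_ae ?_
            filter_upwards [ae_all_iff.2 h5] with x hx
            rw [Finset.sum_apply, Real.norm_of_nonneg (by positivity)]
            simp only [hx]
            exact norm_le_sum_norm_apply _
        _ ≤ ∑ i, eLpNorm (fun x => ‖G i x‖) 2 (volume.restrict Ω) :=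
            eLpNorm_sum_le (fun i _ => (Lp.aestronglyMeasurable (G i)).norm) (by norm_num)
        _ = _ := by simp [Lp.enorm_def]
    -- The gradient carries the sup norm over three directions, hence the factor `3`.
    have k3 : ∑ i, ‖G i‖ₑ ≤ 3 * ‖G‖ₑ := by
      calc ∑ i, ‖G i‖ₑ ≤ ∑ _i : Fin 3, ‖G‖ₑ :=
            Finset.sum_le_sum fun i _ => by
              simpa [enorm_eq_nnnorm] using nnnorm_le_pi_nnnorm G i
        _ = _ := by simp
    calc eLpNorm v q (volume.restrict Ω) = eLpNorm φ q (volume.restrict Ω) := eLpNorm_congr_ae h4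
      _ ≤ eLpNorm φ q volume := eLpNorm_restrict_le _ _ _ _
      _ ≤ C₀ * eLpNorm (fderiv ℝ φ) 2 volume := k1
      _ ≤ C₀ * (3 * ‖G‖ₑ) := by gcongr; exact k2.trans k3
      _ = _ := by push_cast; rw [mul_assoc]
  refine ⟨C₀ * 3, fun x hx => ?_⟩
  -- Smooth approximants converge almost everywhere along a subsequence, and Fatou's lemma carries
  -- the `L^q` bound to the limit.
  obtain ⟨z, hz, hlim⟩ := mem_closure_iff_seq_limit.1 hx
  have hlim1 : Tendsto (fun n => (z n).1) atTop (𝓝 x.1) := (continuous_fst.tendsto _).comp hlim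
  obtain ⟨ns, hns, hae⟩ := (tendstoInMeasure_of_tendsto_Lp hlim1).exists_seq_tendsto_ae
  have hlim2 : Tendsto (fun n => ((C₀ * 3 : NNReal) : ENNReal) * ‖(z (ns n)).2‖ₑ) atTop
      (𝓝 ((C₀ * 3 : NNReal) * ‖x.2‖ₑ)) := by
    refine ENNReal.Tendsto.const_mul ?_ (Or.inr ENNReal.coe_ne_top)
    exact ((continuous_enorm.comp continuous_snd).tendsto _).comp (hlim.comp hns.tendsto_atTop)
  calc eLpNorm x.1 q (volume.restrict Ω)
      ≤ liminf (fun n => eLpNorm (z (ns n)).1 q (volume.restrict Ω)) atTop :=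
        Lp.eLpNorm_lim_le_liminf_eLpNorm (fun n => Lp.aestronglyMeasurable _) _ hae
    _ ≤ liminf (fun n => ((C₀ * 3 : NNReal) : ENNReal) * ‖(z (ns n)).2‖ₑ) atTop :=
        liminf_le_liminf (.of_forall fun n => htest _ (hz _))
    _ = _ := hlim2.liminf_eq

/-- Integration by parts on `H¹₀(Ω)`. -/
theorem integral_inner_fderiv_of_mem_H10Graph {Ω : Set V} {x : L2 Ω V × (Fin 3 → L2 Ω V)}
    (hx : x ∈ H10Graph Ω) {ζ : V → V} (hζ : ContDiff ℝ 1 ζ) (hζc : HasCompactSupport ζ)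
    (i : Fin 3) :
    ∫ y in Ω, inner ℝ (x.1 y) (fderiv ℝ ζ y (e i)) = -∫ y in Ω, inner ℝ (x.2 i y) (ζ y) := by
  have hdc : Continuous fun y => fderiv ℝ ζ y (e i) :=
    (hζ.continuous_fderiv one_ne_zero).clm_apply continuous_const
  have hdcs : HasCompactSupport fun y => fderiv ℝ ζ y (e i) := hζc.fderiv_apply ℝ (e i)
  have hZ : MemLp ζ 2 (volume.restrict Ω) :=
    (hζ.continuous.memLp_of_hasCompactSupport hζc).restrict Ω
  have hZ' : MemLp (fun y => fderiv ℝ ζ y (e i)) 2 (volume.restrict Ω) :=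
    (hdc.memLp_of_hasCompactSupport hdcs).restrict Ω
  have hin : ∀ (v : L2 Ω V) {g : V → V} (hg : MemLp g 2 (volume.restrict Ω)),
      inner ℝ v (hg.toLp g) = ∫ y in Ω, inner ℝ (v y) (g y) := by
    intro v g hg
    rw [L2.inner_def]
    refine integral_congr_ae ?_
    filter_upwards [hg.coeFn_toLp] with y hy
    rw [hy]
  rw [← hin _ hZ', ← hin _ hZ]
  -- The identity is a closed condition on the graph, so it suffices to check smooth `φ` supported
  -- in `Ω`; `ζ` itself need not vanish on the boundary.
  have hcl : IsClosed {z : L2 Ω V × (Fin 3 → L2 Ω V) |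
      inner ℝ z.1 (hZ'.toLp _) = -inner ℝ (z.2 i) (hZ.toLp _)} :=
    isClosed_eq (by fun_prop) (by fun_prop)
  refine closure_minimal (t := {z : L2 Ω V × (Fin 3 → L2 Ω V) |
      inner ℝ z.1 (hZ'.toLp _) = -inner ℝ (z.2 i) (hZ.toLp _)}) ?_ hcl hx
  rintro ⟨v, G⟩ ⟨φ, h1, h2, h3, h4, h5⟩
  change inner ℝ v (hZ'.toLp _) = -inner ℝ (G i) (hZ.toLp _)
  rw [hin, hin]
  have e1 : ∫ y in Ω, inner ℝ (v y) (fderiv ℝ ζ y (e i)) =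
      ∫ y, inner ℝ (φ y) (fderiv ℝ ζ y (e i)) := by
    rw [← setIntegral_eq_integral_of_forall_compl_eq_zero (s := Ω)
      (f := fun y => inner ℝ (φ y) (fderiv ℝ ζ y (e i)))]
    · refine integral_congr_ae ?_
      filter_upwards [h4] with y hy
      rw [hy]
    · intro y hy
      rw [image_eq_zero_of_notMem_tsupport fun h => hy (h3 h), inner_zero_left]
  have e2 : ∫ y in Ω, inner ℝ (G i y) (ζ y) = ∫ y, inner ℝ (fderiv ℝ φ y (e i)) (ζ y) := by
    rw [← setIntegral_eq_integral_of_forall_compl_eq_zero (s := Ω)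
      (f := fun y => inner ℝ (fderiv ℝ φ y (e i)) (ζ y))]
    · refine integral_congr_ae ?_
      filter_upwards [h5 i] with y hy
      rw [hy]
    · intro y hy
      rw [image_eq_zero_of_notMem_tsupport fun h => hy (h3 (tsupport_fderiv_subset ℝ h))]
      simp
  rw [e1, e2]
  have hφ1 : ContDiff ℝ 1 φ := h1.of_le (by exact_mod_cast le_top)
  have hdφ : Continuous fun y => fderiv ℝ φ y (e i) :=
    (hφ1.continuous_fderiv one_ne_zero).clm_apply continuous_const
  have hcs : ∀ {g : V → V}, HasCompactSupport fun y => inner ℝ (φ y) (g y) := fun {g} =>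
    h2.mono fun y hy => by
      contrapose! hy
      simp only [Function.mem_support, not_not] at hy ⊢
      rw [hy, inner_zero_left]
  refine integral_bilinear_fderiv_right_eq_neg_left_of_integrable (B := innerSL ℝ) ?_ ?_ ?_
    (fun y _ => hφ1.differentiable one_ne_zero y) (fun y _ => hζ.differentiable one_ne_zero y)
  · refine (hdφ.inner hζ.continuous).integrable_of_hasCompactSupport (hζc.mono fun y hy => ?_)
    contrapose! hy
    simp only [Function.mem_support, not_not] at hy ⊢
    rw [hy, ContinuousLinearMap.map_zero]
  · exact (hφ1.continuous.inner hdc).integrable_of_hasCompactSupport hcs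
  · exact (hφ1.continuous.inner hζ.continuous).integrable_of_hasCompactSupport hcs

/-! ### Functions of time with integrable distributional derivative -/

lemma contDiff_smoothTransition : ContDiff ℝ ∞ Real.smoothTransition :=
  Real.smoothTransition.contDiff

lemma deriv_smoothTransition_eq_zero {y : ℝ} (hy : y ∉ Icc (0 : ℝ) 1) :
    deriv Real.smoothTransition y = 0 := by
  rw [mem_Icc, not_and_or, not_le, not_le] at hy
  rcases hy with hy | hy
  · have : Real.smoothTransition =ᶠ[𝓝 y] fun _ => 0 := by
      filter_upwards [Iio_mem_nhds hy] with z hz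
      exact Real.smoothTransition.zero_of_nonpos (le_of_lt hz)
    rw [this.deriv_eq, deriv_const]
  · have : Real.smoothTransition =ᶠ[𝓝 y] fun _ => 1 := by
      filter_upwards [Ioi_mem_nhds hy] with z hz
      exact Real.smoothTransition.one_of_one_le (le_of_lt hz)
    rw [this.deriv_eq, deriv_const]

lemma hasCompactSupport_deriv_smoothTransition :
    HasCompactSupport (deriv Real.smoothTransition) :=
  HasCompactSupport.intro isCompact_Icc fun _ h => deriv_smoothTransition_eq_zero h

lemma continuous_deriv_smoothTransition : Continuous (deriv Real.smoothTransition) :=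
  contDiff_smoothTransition.continuous_deriv (by simp)

lemma integrable_deriv_smoothTransition : Integrable (deriv Real.smoothTransition) :=
  continuous_deriv_smoothTransition.integrable_of_hasCompactSupport
    hasCompactSupport_deriv_smoothTransition

lemma integral_deriv_smoothTransition : ∫ y, deriv Real.smoothTransition y = 1 := by
  have h := integral_of_hasDerivAt_of_tendsto (f := Real.smoothTransition)
    (f' := deriv Real.smoothTransition) (m := 0) (n := 1)
    (fun x => (contDiff_smoothTransition.differentiable (by simp) x).hasDerivAt)
    integrable_deriv_smoothTransition ?_ ?_
  · simpa using h
  · refine tendsto_const_nhds.congr' ?_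
    filter_upwards [eventually_le_atBot 0] with x hx
    exact (Real.smoothTransition.zero_of_nonpos hx).symm
  · refine tendsto_const_nhds.congr' ?_
    filter_upwards [eventually_ge_atTop 1] with x hx
    exact (Real.smoothTransition.one_of_one_le hx).symm

/-- The smoothed Heaviside functions have derivatives that concentrate at the jump. -/
lemma tendsto_integral_deriv_smoothTransition {c : ℝ → ℝ} (hc : Continuous c) {M : ℝ}
    (hM : ∀ x, |c x| ≤ M) (s : ℝ) :
    Tendsto (fun n : ℕ => ∫ x, (n + 1 : ℝ) * deriv Real.smoothTransition ((n + 1) * (x - s)) * c x)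
      atTop (𝓝 (c s)) := by
  have h1 : ∀ n : ℕ, ∫ x, (n + 1 : ℝ) * deriv Real.smoothTransition ((n + 1) * (x - s)) * c x =
      ∫ y, deriv Real.smoothTransition y * c (s + y / (n + 1)) := by
    intro n
    have hn : (n + 1 : ℝ) ≠ 0 := by positivity
    have k1 := integral_sub_right_eq_self (μ := volume) (fun x : ℝ =>
      (n + 1 : ℝ) * (deriv Real.smoothTransition ((n + 1) * x) * c (s + x))) s
    have k2 := Measure.integral_comp_mul_left
      (fun y => deriv Real.smoothTransition y * c (s + y / (n + 1))) (n + 1 : ℝ)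
    have k3 : ∀ x : ℝ, (n + 1 : ℝ) * x / (n + 1) = x := fun x => by field_simp
    simp only [k3] at k2
    calc _ = ∫ x, (n + 1 : ℝ) * (deriv Real.smoothTransition ((n + 1) * (x - s)) *
          c (s + (x - s))) := by
          refine integral_congr_ae (.of_forall fun x => ?_)
          simp only [add_sub_cancel, mul_assoc]
      _ = _ := by
          rw [k1, integral_const_mul, k2, abs_of_pos (by positivity), smul_eq_mul]
          field_simp
  simp_rw [h1]
  have h2 : c s = ∫ y, deriv Real.smoothTransition y * c s := by
    rw [integral_mul_const, integral_deriv_smoothTransition, one_mul]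
  rw [h2]
  refine tendsto_integral_of_dominated_convergence (fun y => |deriv Real.smoothTransition y| * M)
    (fun n => ?_) (integrable_deriv_smoothTransition.abs.mul_const M) (fun n => ?_) ?_
  · exact (continuous_deriv_smoothTransition.mul (by fun_prop)).aestronglyMeasurable
  · refine .of_forall fun y => ?_
    rw [norm_mul, Real.norm_eq_abs, Real.norm_eq_abs]
    gcongr
    exact hM _
  · refine .of_forall fun y => ?_
    refine Tendsto.const_mul _ ((hc.tendsto s).comp ?_)
    have h3 : Tendsto (fun n : ℕ => y / ((n : ℝ) + 1)) atTop (𝓝 0) :=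
      tendsto_const_nhds.div_atTop (tendsto_natCast_atTop_atTop.atTop_add tendsto_const_nhds)
    simpa using tendsto_const_nhds.add h3

/-- A continuous function whose distributional derivative on `(0, T)` is integrable is the
integral of that derivative. -/
theorem sub_eq_integral_of_distributional_deriv {T : ℝ} (hT : 0 < T) {c m : ℝ → ℝ}
    (hc : ContinuousOn c (Icc 0 T)) (hm : IntegrableOn m (Ioo 0 T))
    (h : ∀ η : ℝ → ℝ, ContDiff ℝ ∞ η → HasCompactSupport η → tsupport η ⊆ Ioo 0 T →
      ∫ t in Ioo 0 T, (deriv η t * c t + η t * m t) = 0) {s t : ℝ} (hs : 0 ≤ s) (hst : s ≤ t)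
    (ht : t ≤ T) :
    c t - c s = ∫ r in s..t, m r := by
  -- Extension by constants gives a bounded continuous function on the line, to which the
  -- concentrating derivatives can be applied.
  let c' : ℝ → ℝ := fun x => c (projIcc 0 T hT.le x)
  have hc' : Continuous c' := hc.comp_continuous (by fun_prop) fun x => (projIcc 0 T hT.le x).2
  have hcc' : ∀ x ∈ Icc 0 T, c' x = c x := fun x hx => by
    simp only [c', projIcc_of_mem hT.le hx]
  obtain ⟨M, hM⟩ := isCompact_Icc.exists_bound_of_continuousOn hc
  have hM' : ∀ x, |c' x| ≤ M := fun x => hM _ (projIcc 0 T hT.le x).2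
  have hmT : IntervalIntegrable m volume 0 T := by
    rwa [intervalIntegrable_iff_integrableOn_Ioo_of_le hT.le]
  have hsub : ∀ {a b : ℝ}, a ∈ Icc 0 T → b ∈ Icc 0 T → IntervalIntegrable m volume a b :=
    fun {a b} ha hb => hmT.mono_set (by
      rw [uIcc_of_le hT.le]; exact uIcc_subset_Icc ha hb)
  have inner_case : ∀ s t : ℝ, 0 < s → s ≤ t → t < T → c t - c s = ∫ r in s..t, m r := by
    intro s t hs hst ht
    -- Smoothed indicators of `(s, t]`: both jumps are spread to the right, so the support stays
    -- inside `(0, T)` for large `n`, and the derivatives tend to `δ_s - δ_t`.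
    let η : ℕ → ℝ → ℝ := fun n x => Real.smoothTransition ((n + 1) * (x - s)) -
      Real.smoothTransition ((n + 1) * (x - t))
    have hη : ∀ n, ContDiff ℝ ∞ (η n) := fun n =>
      (contDiff_smoothTransition.comp (by fun_prop)).sub
        (contDiff_smoothTransition.comp (by fun_prop))
    have hηd : ∀ n x, deriv (η n) x =
        (n + 1) * deriv Real.smoothTransition ((n + 1) * (x - s)) -
        (n + 1) * deriv Real.smoothTransition ((n + 1) * (x - t)) := by
      intro n x
      have k : ∀ a : ℝ, HasDerivAt (fun x => Real.smoothTransition ((n + 1) * (x - a)))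
          ((n + 1) * deriv Real.smoothTransition ((n + 1) * (x - a))) x := by
        intro a
        have k1 := (contDiff_smoothTransition.differentiable (by simp)
          (((n : ℝ) + 1) * (x - a))).hasDerivAt
        have k2 : HasDerivAt (fun x : ℝ => ((n : ℝ) + 1) * (x - a)) ((n : ℝ) + 1) x := by
          simpa using ((hasDerivAt_id x).sub_const a).const_mul ((n : ℝ) + 1)
        rw [mul_comm]
        exact k1.comp x k2
      exact ((k s).sub (k t)).deriv
    have hη0 : ∀ (n : ℕ) (x : ℝ), x ∉ Icc s (t + 1 / (n + 1)) → η n x = 0 := by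
      intro n x hx
      have hn : (0 : ℝ) < n + 1 := by positivity
      rw [mem_Icc, not_and_or, not_le, not_le] at hx
      rcases hx with hx | hx
      · simp only [η]
        rw [Real.smoothTransition.zero_of_nonpos, Real.smoothTransition.zero_of_nonpos, sub_zero]
        · exact mul_nonpos_of_nonneg_of_nonpos hn.le (by linarith)
        · exact mul_nonpos_of_nonneg_of_nonpos hn.le (by linarith)
      · have h1 : 1 ≤ (n + 1 : ℝ) * (x - t) := by
          have : 1 / (n + 1 : ℝ) < x - t := by linarith
          rw [div_lt_iff₀ hn] at this
          linarith
        have h2 : 1 ≤ (n + 1 : ℝ) * (x - s) := h1.trans (by gcongr)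
        simp only [η]
        rw [Real.smoothTransition.one_of_one_le h1, Real.smoothTransition.one_of_one_le h2,
          sub_self]
    have hηsupp : ∀ n, tsupport (η n) ⊆ Icc s (t + 1 / (n + 1)) := fun n =>
      closure_minimal (fun x hx => by
        by_contra h
        exact hx (hη0 n x h)) isClosed_Icc
    have hηc : ∀ n, HasCompactSupport (η n) := fun n =>
      HasCompactSupport.intro isCompact_Icc (hη0 n)
    have hηsub : ∀ᶠ n : ℕ in atTop, tsupport (η n) ⊆ Ioo 0 T := by
      have : Tendsto (fun n : ℕ => t + 1 / ((n : ℝ) + 1)) atTop (𝓝 (t + 0)) :=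
        tendsto_const_nhds.add tendsto_one_div_add_atTop_nhds_zero_nat
      rw [add_zero] at this
      filter_upwards [this.eventually (gt_mem_nhds ht)] with n hn
      exact (hηsupp n).trans fun x hx => ⟨hs.trans_le hx.1, hx.2.trans_lt hn⟩
    have hηbd : ∀ n x, |η n x| ≤ 1 := by
      intro n x
      have h1 := Real.smoothTransition.nonneg (((n : ℝ) + 1) * (x - s))
      have h2 := Real.smoothTransition.le_one (((n : ℝ) + 1) * (x - s))
      have h3 := Real.smoothTransition.nonneg (((n : ℝ) + 1) * (x - t))
      have h4 := Real.smoothTransition.le_one (((n : ℝ) + 1) * (x - t))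
      simp only [η]
      rw [abs_le]; constructor <;> linarith
    have hηlim : ∀ x, Tendsto (fun n => η n x) atTop (𝓝 ((Ioc s t).indicator 1 x)) := by
      have hstep : ∀ a x : ℝ, Tendsto (fun n : ℕ => Real.smoothTransition ((n + 1) * (x - a))) atTop
          (𝓝 ((Ioi a).indicator 1 x)) := by
        intro a x
        rcases le_or_gt x a with hx | hx
        · rw [indicator_of_notMem (by simpa using hx)]
          refine tendsto_const_nhds.congr fun n => ?_
          rw [Real.smoothTransition.zero_of_nonpos]
          exact mul_nonpos_of_nonneg_of_nonpos (by positivity) (by linarith)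
        · rw [indicator_of_mem (mem_Ioi.2 hx)]
          refine tendsto_const_nhds.congr' ?_
          have : Tendsto (fun n : ℕ => ((n : ℝ) + 1) * (x - a)) atTop atTop :=
            (tendsto_natCast_atTop_atTop.atTop_add tendsto_const_nhds).atTop_mul_const (by linarith)
          filter_upwards [this.eventually_ge_atTop 1] with n hn
          rw [Real.smoothTransition.one_of_one_le hn]; rfl
      intro x
      have := (hstep s x).sub (hstep t x)
      convert this using 2
      simp only [indicator, mem_Ioc, mem_Ioi, Pi.one_apply]
      split_ifs <;> first | (norm_num; done) | (exfalso; grind)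
    have lim1 : Tendsto (fun n => ∫ x in Ioo 0 T, η n x * m x) atTop
        (𝓝 (∫ x in Ioo 0 T, (Ioc s t).indicator 1 x * m x)) := by
      refine tendsto_integral_of_dominated_convergence (fun x => |m x|) (fun n => ?_) hm.abs
        (fun n => ?_) (.of_forall fun x => (hηlim x).mul_const _)
      · exact (hη n).continuous.aestronglyMeasurable.mul hm.1
      · refine .of_forall fun x => ?_
        rw [norm_mul, Real.norm_eq_abs, Real.norm_eq_abs]
        calc |η n x| * |m x| ≤ 1 * |m x| := by gcongr; exact hηbd n x
          _ = _ := one_mul _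
    have e1 : ∫ x in Ioo 0 T, (Ioc s t).indicator 1 x * m x = ∫ r in s..t, m r := by
      have : ∀ x, (Ioc s t).indicator 1 x * m x = (Ioc s t).indicator m x := fun x => by
        by_cases hx : x ∈ Ioc s t <;> simp [hx]
      simp_rw [this]
      rw [setIntegral_indicator measurableSet_Ioc, intervalIntegral.integral_of_le hst,
        inter_eq_right.2]
      exact fun x hx => ⟨hs.trans hx.1, hx.2.trans_lt ht⟩
    have lim2 := (tendsto_integral_deriv_smoothTransition hc' hM' s).sub
      (tendsto_integral_deriv_smoothTransition hc' hM' t)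
    have e2 : ∀ᶠ n : ℕ in atTop,
        (∫ x, (n + 1 : ℝ) * deriv Real.smoothTransition ((n + 1) * (x - s)) * c' x) -
        (∫ x, (n + 1 : ℝ) * deriv Real.smoothTransition ((n + 1) * (x - t)) * c' x) =
        -∫ x in Ioo 0 T, η n x * m x := by
      filter_upwards [hηsub] with n hn
      have hi : ∀ a : ℝ, Integrable fun x =>
          (n + 1 : ℝ) * deriv Real.smoothTransition ((n + 1) * (x - a)) * c' x := by
        intro a
        have k1 : Integrable fun x => deriv Real.smoothTransition (((n : ℝ) + 1) * (x - a)) :=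
          (integrable_deriv_smoothTransition.comp_mul_left' (by positivity)).comp_sub_right a
        refine (k1.const_mul ((n : ℝ) + 1)).mul_bdd (c := M) hc'.aestronglyMeasurable
          (.of_forall fun x => hM' x)
      rw [← integral_sub (hi s) (hi t)]
      have k2 : ∀ x, (n + 1 : ℝ) * deriv Real.smoothTransition ((n + 1) * (x - s)) * c' x -
          (n + 1 : ℝ) * deriv Real.smoothTransition ((n + 1) * (x - t)) * c' x =
          deriv (η n) x * c' x := fun x => by rw [hηd]; ring
      simp_rw [k2]
      have k3 : ∫ x, deriv (η n) x * c' x = ∫ x in Ioo 0 T, deriv (η n) x * c x := by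
        rw [← setIntegral_eq_integral_of_forall_compl_eq_zero (s := Ioo 0 T)]
        · refine setIntegral_congr_fun measurableSet_Ioo fun x hx => ?_
          simp only [hcc' x ⟨hx.1.le, hx.2.le⟩]
        · intro x hx
          rw [image_eq_zero_of_notMem_tsupport fun h' => hx (hn (tsupport_deriv_subset h')),
            zero_mul]
      have k4 := h (η n) (hη n) (hηc n) hn
      have k5 : IntegrableOn (fun x => deriv (η n) x * c x) (Ioo 0 T) := by
        have k6 := ((hi s).sub (hi t)).integrableOn (s := Ioo 0 T)
        refine k6.congr_fun (fun x hx => ?_) measurableSet_Ioo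
        simp only [Pi.sub_apply]
        rw [k2, hcc' x ⟨hx.1.le, hx.2.le⟩]
      have k6 : IntegrableOn (fun x => η n x * m x) (Ioo 0 T) :=
        hm.bdd_mul (c := 1) (hη n).continuous.aestronglyMeasurable (.of_forall fun x => hηbd n x)
      rw [integral_add k5 k6] at k4
      rw [k3]
      linarith
    have := tendsto_nhds_unique (lim2.congr' e2) lim1.neg
    rw [e1, hcc' s ⟨hs.le, hst.trans ht.le⟩, hcc' t ⟨(hs.trans_le hst).le, ht.le⟩] at this
    linarith
  have hk : ContinuousOn (fun x => c x - ∫ r in (0 : ℝ)..x, m r) (Icc 0 T) := by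
    refine hc.sub ?_
    have := intervalIntegral.continuousOn_primitive_interval (a := 0) (b := T) (f := m)
      (μ := volume) (by rw [uIcc_of_le hT.le]; rwa [integrableOn_Icc_iff_integrableOn_Ioo])
    rwa [uIcc_of_le hT.le] at this
  -- The interior formula makes `c` minus a primitive of `m` constant on `(0, T)`; continuity
  -- extends this to the endpoints.
  have hconst : EqOn (fun x => c x - ∫ r in (0 : ℝ)..x, m r)
      (fun _ => c (T / 2) - ∫ r in (0 : ℝ)..(T / 2), m r) (Ioo 0 T) := by
    have hmid : T / 2 ∈ Ioo 0 T := ⟨by linarith, by linarith⟩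
    have h0 : (0 : ℝ) ∈ Icc 0 T := ⟨le_rfl, hT.le⟩
    intro x hx
    simp only
    have k1 := intervalIntegral.integral_add_adjacent_intervals
      (hsub h0 (Ioo_subset_Icc_self hmid)) (hsub (Ioo_subset_Icc_self hmid) (Ioo_subset_Icc_self hx))
    have k2 : c x - c (T / 2) = ∫ r in (T / 2)..x, m r := by
      rcases le_total x (T / 2) with hx' | hx'
      · rw [intervalIntegral.integral_symm, ← inner_case x (T / 2) hx.1 hx' hmid.2]; ring
      · exact inner_case (T / 2) x hmid.1 hx' hx.2
    linarith
  have hall := hconst.of_subset_closure hk continuousOn_const Ioo_subset_Icc_self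
    (by rw [closure_Ioo hT.ne])
  have ks := hall ⟨hs, hst.trans ht⟩
  have kt := hall ⟨hs.trans hst, ht⟩
  simp only at ks kt
  have k1 := intervalIntegral.integral_add_adjacent_intervals
    (hsub ⟨le_rfl, hT.le⟩ ⟨hs, hst.trans ht⟩) (hsub ⟨hs, hst.trans ht⟩ ⟨hs.trans hst, ht⟩)
  linarith

/-! ### Jointly measurable representatives of solutions -/

/-- The measure on the space-time cylinder is a product measure. -/
lemma restrict_prod_restrict (I : Set ℝ) (Ω : Set V) :
    (volume.restrict I).prod (volume.restrict Ω) = (volume : Measure (ℝ × V)).restrict (I ×ˢ Ω) := by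
  rw [Measure.prod_restrict, Measure.volume_eq_prod]

/-- `w` is a jointly measurable representative of the curve `v` of `L²` functions, square
integrable on the cylinder `(0, T) × Ω` and extended by zero. -/
structure SpaceTimeRep (Ω : Set V) (T : ℝ) {F : Type} [NormedAddCommGroup F] [MeasurableSpace F]
    (v : ℝ → L2 Ω F) (w : ℝ × V → F) : Prop where
  measurable : Measurable w
  ae_eq : ∀ᵐ t ∂(volume.restrict (Ioo 0 T)), (fun x => w (t, x)) =ᵐ[volume.restrict Ω] v t
  memLp : MemLp w 2
  eq_zero : ∀ z, z ∉ Ioo 0 T ×ˢ Ω → w z = 0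

/-- Tonelli on the cylinder, outside which `w` vanishes. It transfers the iterated bounds on a curve
to `Lʳ` bounds over space-time. -/
lemma lintegral_enorm_rpow_eq {Ω : Set V} (hΩ : IsOpen Ω) {T : ℝ} {F : Type}
    [NormedAddCommGroup F] [MeasurableSpace F] [OpensMeasurableSpace F] {v : ℝ → L2 Ω F}
    {w : ℝ × V → F} (hw : Measurable w)
    (hae : ∀ᵐ t ∂(volume.restrict (Ioo 0 T)), (fun x => w (t, x)) =ᵐ[volume.restrict Ω] v t)
    (h0 : ∀ z, z ∉ Ioo 0 T ×ˢ Ω → w z = 0) {r : ℝ} (hr : 0 < r) :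
    ∫⁻ z, ‖w z‖ₑ ^ r = ∫⁻ t in Ioo 0 T, ∫⁻ x in Ω, ‖v t x‖ₑ ^ r := by
  have hcyl : MeasurableSet (Ioo 0 T ×ˢ Ω) := measurableSet_Ioo.prod hΩ.measurableSet
  have h1 : ∫⁻ z, ‖w z‖ₑ ^ r = ∫⁻ z in Ioo 0 T ×ˢ Ω, ‖w z‖ₑ ^ r := by
    rw [setLIntegral_eq_of_support_subset]
    intro z hz
    by_contra h
    exact hz (by simp [h0 z h, hr])
  rw [h1, ← restrict_prod_restrict, lintegral_prod _ (by fun_prop)]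
  refine lintegral_congr_ae ?_
  filter_upwards [hae] with t ht
  refine lintegral_congr_ae ?_
  filter_upwards [ht] with x hx
  rw [hx]

/-- A square integrable curve of `L²` functions has a jointly measurable representative. -/
theorem exists_spaceTimeRep {Ω : Set V} (hΩ : IsOpen Ω) {T : ℝ} {F : Type} [NormedAddCommGroup F]
    [CompleteSpace F] [MeasurableSpace F] [BorelSpace F] [SecondCountableTopology F]
    {v : ℝ → L2 Ω F} (hv : MemLp v 2 (volume.restrict (Ioo 0 T))) :
    ∃ w, SpaceTimeRep Ω T v w := by
  obtain ⟨w, hw, hwv⟩ := exists_measurable_uncurry hv.1.stronglyMeasurable_mk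
  have hcyl : MeasurableSet (Ioo 0 T ×ˢ Ω) := measurableSet_Ioo.prod hΩ.measurableSet
  have hm : Measurable ((Ioo 0 T ×ˢ Ω).indicator w) := hw.indicator hcyl
  have hae : ∀ᵐ t ∂(volume.restrict (Ioo 0 T)),
      (fun x => (Ioo 0 T ×ˢ Ω).indicator w (t, x)) =ᵐ[volume.restrict Ω] v t := by
    filter_upwards [hv.1.ae_eq_mk, ae_restrict_mem measurableSet_Ioo] with t ht htT
    rw [ht]
    filter_upwards [hwv t, ae_restrict_mem hΩ.measurableSet] with x hx hxΩ
    rw [indicator_of_mem (mk_mem_prod htT hxΩ), hx]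
  have h0 : ∀ z, z ∉ Ioo 0 T ×ˢ Ω → (Ioo 0 T ×ˢ Ω).indicator w z = 0 :=
    fun z hz => indicator_of_notMem hz _
  refine ⟨_, hm, hae, ⟨hm.aestronglyMeasurable, ?_⟩, h0⟩
  rw [eLpNorm_lt_top_iff_lintegral_rpow_enorm_lt_top (by norm_num) (by norm_num)]
  rw [lintegral_enorm_rpow_eq hΩ hm hae h0 (by norm_num)]
  have h2 := hv.2
  rw [eLpNorm_lt_top_iff_lintegral_rpow_enorm_lt_top (by norm_num) (by norm_num)] at h2
  refine lt_of_eq_of_lt (lintegral_congr fun t => ?_) h2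
  rw [Lp.enorm_def, eLpNorm_eq_lintegral_rpow_enorm_toReal (by norm_num) (by norm_num)]
  simp only [ENNReal.toReal_ofNat, ENNReal.rpow_ofNat]
  rw [← ENNReal.rpow_natCast, ← ENNReal.rpow_mul]
  norm_num

lemma SpaceTimeRep.sub {Ω : Set V} {T : ℝ} {F : Type} [NormedAddCommGroup F]
    [MeasurableSpace F] [BorelSpace F] [SecondCountableTopology F]
    {v₁ v₂ : ℝ → L2 Ω F} {w₁ w₂ : ℝ × V → F} (h₁ : SpaceTimeRep Ω T v₁ w₁)
    (h₂ : SpaceTimeRep Ω T v₂ w₂) :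
    SpaceTimeRep Ω T (fun t => v₁ t - v₂ t) (fun z => w₁ z - w₂ z) where
  measurable := h₁.measurable.sub h₂.measurable
  ae_eq := by
    filter_upwards [h₁.ae_eq, h₂.ae_eq] with t k₁ k₂
    exact (k₁.sub k₂).trans (Lp.coeFn_sub _ _).symm
  memLp := h₁.memLp.sub h₂.memLp
  eq_zero z hz := by rw [h₁.eq_zero z hz, h₂.eq_zero z hz, sub_zero]

section Solutions

variable {Ω : Set V}

/-- On a set of finite measure the mean is the pairing with the constant `1`, a continuous
functional. Closedness supplies the completeness needed for orthogonal projection and uniform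
boundedness. -/
lemma isClosed_L2bar (hb : volume Ω ≠ ⊤) : IsClosed (L2bar Ω : Set (L2 Ω ℝ)) := by
  have hfin : IsFiniteMeasure (volume.restrict Ω : Measure V) :=
    ⟨by rw [Measure.restrict_apply_univ]; exact hb.lt_top⟩
  have : (L2bar Ω : Set (L2 Ω ℝ)) =
      {p | inner ℝ (indicatorConstLp 2 MeasurableSet.univ
        (measure_ne_top (volume.restrict Ω) univ) (1 : ℝ)) p = 0} := by
    ext p
    simp only [mem_ofPred_eq, L2.inner_indicatorConstLp_one, Measure.restrict_univ]
    exact ⟨fun h => h.2, fun h => ⟨(Lp.memLp p).integrable (by norm_num), h⟩⟩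
  rw [this]
  exact isClosed_eq (by fun_prop) continuous_const

lemma completeSpace_L2bar (hb : volume Ω ≠ ⊤) : CompleteSpace (L2bar Ω) :=
  (isClosed_L2bar hb).completeSpace_coe

/-- Weak continuity in the energy space of the velocity component. -/
lemma continuousOn_inner_fst {U : ℝ → E Ω} {s : Set ℝ}
    (hU : ∀ w : E Ω, ContinuousOn (fun t => inner ℝ w (U t)) s) (v : L2 Ω V) :
    ContinuousOn (fun t => inner ℝ v (U t).fst) s := by
  simpa [WithLp.prod_inner_apply] using hU (WithLp.toLp 2 (v, 0))

/-- Weak continuity in the energy space of the pressure component. -/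
lemma continuousOn_inner_snd (hb : volume Ω ≠ ⊤) {U : ℝ → E Ω} {s : Set ℝ}
    (hU : ∀ w : E Ω, ContinuousOn (fun t => inner ℝ w (U t)) s) (χ : L2 Ω ℝ) :
    ContinuousOn (fun t => inner ℝ χ ((U t).snd : L2 Ω ℝ)) s := by
  have := completeSpace_L2bar hb
  -- Projecting `χ` onto the mean-zero functions does not change its pairing with the pressure.
  have h := hU (WithLp.toLp 2 (0, (L2bar Ω).orthogonalProjectionOnto χ))
  simpa [WithLp.prod_inner_apply] using h

/-- Growth of the nonlinearity: it maps `L^(2(l+1))` to the dual space. -/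
theorem IsNonlinearity.memLp_comp {l : ℝ} {f : V → V} (hf : IsNonlinearity l f) {X : Type*}
    [MeasurableSpace X] {μ : Measure X} {u : X → V} (hu : Measurable u) {s : Set X}
    (hs : MeasurableSet s) (hμs : μ s ≠ ⊤) (h0 : ∀ x ∉ s, u x = 0)
    (huq : MemLp u (ENNReal.ofReal (2 * (l + 1))) μ) :
    MemLp (fun x => f (u x)) (ENNReal.ofReal (2 * (l + 1) / (2 * l + 1))) μ := by
  obtain ⟨C, hC, hfC⟩ := hf.norm_le
  have hl := hf.1.1
  -- The power `‖u‖^(2l+1)` has exponent `2(l+1)/(2l+1)`; the constant in the growth bound matters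
  -- only on `s`, which has finite measure.
  have h1 := huq.norm_rpow_div (ENNReal.ofReal (2 * l + 1))
  rw [ENNReal.toReal_ofReal (by linarith), ← ENNReal.ofReal_div_of_pos (by linarith)] at h1
  have h2 : MemLp (s.indicator fun _ => (1 : ℝ))
      (ENNReal.ofReal (2 * (l + 1) / (2 * l + 1))) μ :=
    memLp_indicator_const _ hs 1 (Or.inr hμs)
  refine ((h2.add h1).const_mul C).mono (hf.measurable.comp hu).aestronglyMeasurable
    (.of_forall fun x => ?_)
  by_cases hx : x ∈ s
  · refine (hfC (u x)).trans (le_trans (le_of_eq ?_) (le_abs_self _))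
    simp [hx]
  · rw [h0 x hx, hf.map_zero, norm_zero]
    exact norm_nonneg _

/-- Measurable representatives of the velocity, the pressure and the velocity gradient. -/
theorem IsWeakEnergySolution.exists_spaceTimeRep (hΩ : IsOpen Ω) (hb : volume Ω ≠ ⊤)
    {T l : ℝ} (hT : 0 < T) (hl : 0 < l) {f : V → V} {D : Matrix (Fin 3) (Fin 3) ℝ} {g : L2 Ω V}
    {U : ℝ → E Ω} (hU : IsWeakEnergySolution Ω T l f D g U) :
    ∃ (G : ℝ → Fin 3 → L2 Ω V) (u : ℝ × V → V) (p : ℝ × V → ℝ) (Gu : Fin 3 → ℝ × V → V),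
      (∀ᵐ t ∂(volume.restrict (Ioo 0 T)), ((U t).fst, G t) ∈ H10Graph Ω) ∧
      SpaceTimeRep Ω T (fun t => (U t).fst) u ∧
      SpaceTimeRep Ω T (fun t => ((U t).snd : L2 Ω ℝ)) p ∧
      (∀ i, SpaceTimeRep Ω T (fun t => G t i) (Gu i)) ∧
      MemLp u (ENNReal.ofReal (2 * (l + 1))) := by
  obtain ⟨G, hG, hGH⟩ := hU.memL2H10
  have hu2 : MemLp (fun t => (U t).fst) 2 (volume.restrict (Ioo 0 T)) := by
    refine hG.mono hG.1.fst (.of_forall fun t => ?_)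
    exact norm_fst_le ((U t).fst, G t)
  have hG2 : ∀ i, MemLp (fun t => G t i) 2 (volume.restrict (Ioo 0 T)) := fun i => by
    refine hG.mono ((continuous_apply i).comp_aestronglyMeasurable hG.1.snd)
      (.of_forall fun t => ?_)
    exact (norm_le_pi_norm (G t) i).trans (norm_snd_le ((U t).fst, G t))
  have hpw := continuousOn_inner_snd hb hU.weakly_continuous
  -- Weak continuity supplies both ingredients: measurability, by separability, and boundedness, by
  -- Banach–Steinhaus.
  have hp2 : MemLp (fun t => ((U t).snd : L2 Ω ℝ)) 2 (volume.restrict (Ioo 0 T)) := by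
    obtain ⟨M, hM⟩ := exists_norm_le_of_weakly_continuousOn isCompact_Icc hpw
    have h1 : StronglyMeasurable fun t => ((U (projIcc 0 T hT.le t)).snd : L2 Ω ℝ) := by
      have : Fact ((1 : ENNReal) ≤ 2) := ⟨by norm_num⟩
      have : Fact ((2 : ENNReal) ≠ ⊤) := ⟨by norm_num⟩
      refine stronglyMeasurable_of_weakly_continuous fun χ => ?_
      exact (hpw χ).comp_continuous (by fun_prop) fun x => (projIcc 0 T hT.le x).2
    refine MemLp.of_bound (h1.aestronglyMeasurable.congr ?_) M ?_
    · filter_upwards [ae_restrict_mem measurableSet_Ioo] with t ht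
      rw [projIcc_of_mem hT.le ⟨ht.1.le, ht.2.le⟩]
    · filter_upwards [ae_restrict_mem measurableSet_Ioo] with t ht
      exact hM t ⟨ht.1.le, ht.2.le⟩
  obtain ⟨u, hu⟩ := BrinkmanForchheimer.exists_spaceTimeRep hΩ hu2
  obtain ⟨p, hp⟩ := BrinkmanForchheimer.exists_spaceTimeRep hΩ hp2
  choose Gu hGu using fun i => BrinkmanForchheimer.exists_spaceTimeRep hΩ (hG2 i)
  refine ⟨G, u, p, Gu, hGH, hu, hp, hGu, hu.measurable.aestronglyMeasurable, ?_⟩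
  have hq : 0 < 2 * (l + 1) := by linarith
  rw [eLpNorm_lt_top_iff_lintegral_rpow_enorm_lt_top (by simpa using hq) ENNReal.ofReal_ne_top,
    ENNReal.toReal_ofReal hq.le, lintegral_enorm_rpow_eq hΩ hu.measurable hu.ae_eq hu.eq_zero hq]
  exact hU.memLq

end Solutions

/-! ### Test functions of product form -/

section TestFunctions

lemma real_inner_eq_mul (a b : ℝ) : inner ℝ a b = a * b := by simp [mul_comm]

lemma contDiff_fderiv_apply {F : Type} [NormedAddCommGroup F] [NormedSpace ℝ F] {φ : V → F}
    (hφ : ContDiff ℝ ∞ φ) (v : V) : ContDiff ℝ ∞ fun y => fderiv ℝ φ y v :=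
  (hφ.fderiv_right (m := ∞) (by simp)).clm_apply contDiff_const

/-- In this form one integration by parts per direction moves a derivative from `φ` onto the
velocity. -/
lemma laplacian_eq_sum {φ : V → V} (hφ : ContDiff ℝ ∞ φ) (x : V) :
    Laplacian.laplacian φ x = ∑ i, fderiv ℝ (fun y => fderiv ℝ φ y (e i)) x (e i) := by
  rw [InnerProductSpace.laplacian_eq_iteratedFDeriv_orthonormalBasis φ
    (EuclideanSpace.basisFun (Fin 3) ℝ)]
  refine Finset.sum_congr rfl fun i _ => ?_
  have hd : DifferentiableAt ℝ (fderiv ℝ φ) x :=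
    (hφ.fderiv_right (m := ∞) (by simp)).differentiable (by simp) x
  rw [iteratedFDeriv_two_apply, fderiv_clm_apply hd (differentiableAt_const _)]
  simp

lemma isTest_smul {Ω : Set V} {T : ℝ} {F : Type} [NormedAddCommGroup F] [NormedSpace ℝ F]
    {η : ℝ → ℝ} {φ : V → F} (hη : ContDiff ℝ ∞ η) (hηc : HasCompactSupport η)
    (hηs : tsupport η ⊆ Ioo 0 T) (hφ : ContDiff ℝ ∞ φ) (hφc : HasCompactSupport φ)
    (hφs : tsupport φ ⊆ Ω) : IsTest Ω T fun z : ℝ × V => η z.1 • φ z.2 := by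
  have hsub : tsupport (fun z : ℝ × V => η z.1 • φ z.2) ⊆ tsupport η ×ˢ tsupport φ := by
    refine closure_minimal (fun z hz => ?_) ((isClosed_tsupport η).prod (isClosed_tsupport φ))
    rw [Function.mem_support] at hz
    refine ⟨subset_tsupport η fun h => hz ?_, subset_tsupport φ fun h => hz ?_⟩
    · rw [h, zero_smul]
    · rw [h, smul_zero]
  exact ⟨(hη.comp contDiff_fst).smul (hφ.comp contDiff_snd),
    (hηc.isCompact.prod hφc.isCompact).of_isClosed_subset (isClosed_tsupport _) hsub,
    hsub.trans (prod_mono hηs hφs)⟩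

lemma dt_smul {F : Type} [NormedAddCommGroup F] [NormedSpace ℝ F] {η : ℝ → ℝ}
    (hη : ContDiff ℝ ∞ η) (φ : V → F) (t : ℝ) (x : V) :
    dt (fun z : ℝ × V => η z.1 • φ z.2) t x = deriv η t • φ x := by
  unfold dt
  exact ((hη.differentiable (by simp) t).hasDerivAt.smul_const (φ x)).deriv

lemma divergence_const_smul (c : ℝ) {φ : V → V} (hφ : ContDiff ℝ ∞ φ) (x : V) :
    divergence (fun y => c • φ y) x = c * divergence φ x := by
  unfold divergence
  rw [Finset.mul_sum]
  refine Finset.sum_congr rfl fun i _ => ?_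
  rw [fderiv_fun_const_smul (hφ.differentiable (by simp) x)]
  simp

lemma laplacian_const_smul (c : ℝ) {φ : V → V} (hφ : ContDiff ℝ ∞ φ) (x : V) :
    Laplacian.laplacian (fun y => c • φ y) x = c • Laplacian.laplacian φ x :=
  InnerProductSpace.laplacian_smul c (contDiff_infty.1 hφ 2).contDiffAt

lemma gradient_const_smul (c : ℝ) {χ : V → ℝ} (hχ : ContDiff ℝ ∞ χ) (x : V) :
    ∇ (fun y => c • χ y) x = c • ∇ χ x := by
  unfold gradient
  rw [fderiv_fun_const_smul (hχ.differentiable (by simp) x), map_smul]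

lemma integrable_inner_bounded {X F : Type*} [MeasurableSpace X] {μ : Measure X}
    [NormedAddCommGroup F] [InnerProductSpace ℝ F] {a ζ : X → F} (ha : Integrable a μ)
    (hζ : AEStronglyMeasurable ζ μ) {C : ℝ} (hC : ∀ x, ‖ζ x‖ ≤ C) :
    Integrable (fun x => inner ℝ (a x) (ζ x)) μ := by
  refine (ha.norm.mul_const C).mono' (ha.1.inner hζ) (.of_forall fun x => ?_)
  exact (norm_inner_le_norm _ _).trans (by gcongr; exact hC x)

/-- The pairing of an integrable function on the cylinder with a test function of the space
variable is integrable. -/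
lemma integrable_inner_test {I : Set ℝ} {Ω : Set V} {F : Type*} [NormedAddCommGroup F]
    [InnerProductSpace ℝ F] {a : ℝ × V → F} {ζ : V → F}
    (ha : Integrable a ((volume.restrict I).prod (volume.restrict Ω)))
    (hζ : Continuous ζ) (hζc : HasCompactSupport ζ) :
    Integrable (fun z : ℝ × V => inner ℝ (a z) (ζ z.2))
      ((volume.restrict I).prod (volume.restrict Ω)) := by
  obtain ⟨C, hC⟩ := hζc.exists_bound_of_continuous hζ
  exact integrable_inner_bounded ha (hζ.comp continuous_snd).aestronglyMeasurable
    fun z => hC z.2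

lemma hasCompactSupport_divergence {φ : V → V} (hφ : HasCompactSupport φ) :
    HasCompactSupport (divergence φ) := by
  refine hφ.mono' fun x hx => ?_
  by_contra h
  refine hx ?_
  unfold divergence
  refine Finset.sum_eq_zero fun i _ => ?_
  rw [image_eq_zero_of_notMem_tsupport fun h' => h (tsupport_fderiv_subset ℝ h')]
  simp

lemma continuous_divergence {φ : V → V} (hφ : ContDiff ℝ ∞ φ) : Continuous (divergence φ) := by
  unfold divergence
  refine continuous_finsetSum _ fun i _ => ?_
  exact (EuclideanSpace.proj (𝕜 := ℝ) i).continuous.comp (contDiff_fderiv_apply hφ (e i)).continuous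

lemma continuous_laplacian {φ : V → V} (hφ : ContDiff ℝ ∞ φ) :
    Continuous (Laplacian.laplacian φ) := by
  rw [show Laplacian.laplacian φ = fun x => ∑ i, fderiv ℝ (fun y => fderiv ℝ φ y (e i)) x (e i)
    from funext (laplacian_eq_sum hφ)]
  exact continuous_finsetSum _ fun i _ =>
    (contDiff_fderiv_apply (contDiff_fderiv_apply hφ (e i)) (e i)).continuous

lemma hasCompactSupport_laplacian {φ : V → V} (hφ : ContDiff ℝ ∞ φ) (hφc : HasCompactSupport φ) :
    HasCompactSupport (Laplacian.laplacian φ) := by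
  rw [show Laplacian.laplacian φ = fun x => ∑ i, fderiv ℝ (fun y => fderiv ℝ φ y (e i)) x (e i)
    from funext (laplacian_eq_sum hφ)]
  refine hφc.mono' fun x hx => ?_
  by_contra h
  refine hx (Finset.sum_eq_zero fun i _ => ?_)
  have : x ∉ tsupport (fderiv ℝ fun y => fderiv ℝ φ y (e i)) := fun h' =>
    h (tsupport_fderiv_apply_subset ℝ (e i) (tsupport_fderiv_subset ℝ h'))
  rw [image_eq_zero_of_notMem_tsupport this]
  simp

end TestFunctions

/-! ### The equations tested with products -/

section Slices

variable {Ω : Set V} {T l : ℝ} {f : V → V} {D : Matrix (Fin 3) (Fin 3) ℝ} {g : L2 Ω V}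
  {U : ℝ → E Ω} {u : ℝ × V → V} {p : ℝ × V → ℝ}

/-- The momentum equation tested with a product of functions of time and space. -/
theorem IsWeakEnergySolution.momentum_product (hb : volume Ω ≠ ⊤)
    (hU : IsWeakEnergySolution Ω T l f D g U) (hu : SpaceTimeRep Ω T (fun t => (U t).fst) u)
    (hp : SpaceTimeRep Ω T (fun t => ((U t).snd : L2 Ω ℝ)) p)
    (hfu : Integrable (fun z => f (u z)) ((volume.restrict (Ioo 0 T)).prod (volume.restrict Ω)))
    {η : ℝ → ℝ} (hη : ContDiff ℝ ∞ η) (hηc : HasCompactSupport η) (hηs : tsupport η ⊆ Ioo 0 T)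
    {φ : V → V} (hφ : ContDiff ℝ ∞ φ) (hφc : HasCompactSupport φ) (hφs : tsupport φ ⊆ Ω) :
    Integrable (fun z : ℝ × V => inner ℝ (u z) (φ z.2))
      ((volume.restrict (Ioo 0 T)).prod (volume.restrict Ω)) ∧
    Integrable (fun z : ℝ × V => inner ℝ (u z) (Laplacian.laplacian φ z.2) +
      p z * divergence φ z.2 - inner ℝ (f (u z)) (φ z.2) + inner ℝ (g z.2) (φ z.2))
      ((volume.restrict (Ioo 0 T)).prod (volume.restrict Ω)) ∧
    ∫ t in Ioo 0 T, (deriv η t * (∫ x in Ω, inner ℝ (u (t, x)) (φ x)) +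
      η t * (∫ x in Ω, (inner ℝ (u (t, x)) (Laplacian.laplacian φ x) +
        p (t, x) * divergence φ x - inner ℝ (f (u (t, x))) (φ x) + inner ℝ (g x) (φ x)))) = 0 := by
  have hfin : IsFiniteMeasure (volume.restrict Ω : Measure V) :=
    ⟨by rw [Measure.restrict_apply_univ]; exact hb.lt_top⟩
  have hui : Integrable u ((volume.restrict (Ioo 0 T)).prod (volume.restrict Ω)) := by
    have := (hu.memLp.restrict (Ioo 0 T ×ˢ Ω))
    rw [← restrict_prod_restrict] at this
    exact this.integrable (by norm_num)
  have hpi : Integrable p ((volume.restrict (Ioo 0 T)).prod (volume.restrict Ω)) := by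
    have := (hp.memLp.restrict (Ioo 0 T ×ˢ Ω))
    rw [← restrict_prod_restrict] at this
    exact this.integrable (by norm_num)
  have hgi : Integrable (fun z : ℝ × V => g z.2)
      ((volume.restrict (Ioo 0 T)).prod (volume.restrict Ω)) :=
    ((Lp.memLp g).integrable (by norm_num)).comp_snd _
  have i1 := integrable_inner_test hui hφ.continuous hφc
  have i2 := integrable_inner_test hui (continuous_laplacian hφ) (hasCompactSupport_laplacian hφ hφc)
  have i3 := integrable_inner_test hpi (continuous_divergence hφ) (hasCompactSupport_divergence hφc)
  simp only [real_inner_eq_mul] at i3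
  have i4 := integrable_inner_test hfu hφ.continuous hφc
  have i5 := integrable_inner_test hgi hφ.continuous hφc
  have i6 := ((i2.add i3).sub i4).add i5
  refine ⟨i1, i6, ?_⟩
  have h := hU.momentum _ (isTest_smul hη hηc hηs hφ hφc hφs)
  rw [← neg_eq_zero, ← integral_neg]
  refine Eq.trans (integral_congr_ae ?_) h
  filter_upwards [hu.ae_eq, hp.ae_eq, i1.prod_right_ae, i6.prod_right_ae] with t hut hpt j1 j6
  simp only [Pi.add_apply, Pi.sub_apply] at j6
  rw [← integral_const_mul, ← integral_const_mul,
    ← integral_add (j1.const_mul _) (j6.const_mul _), ← integral_neg]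
  refine integral_congr_ae ?_
  filter_upwards [hut, hpt] with x hux hpx
  rw [dt_smul hη, divergence_const_smul _ hφ, laplacian_const_smul _ hφ, ← hux, ← hpx]
  simp only [inner_smul_right]
  ring

/-- The pressure equation tested with a product of functions of time and space. -/
theorem IsWeakEnergySolution.pressure_product (hb : volume Ω ≠ ⊤)
    (hU : IsWeakEnergySolution Ω T l f D g U) (hu : SpaceTimeRep Ω T (fun t => (U t).fst) u)
    (hp : SpaceTimeRep Ω T (fun t => ((U t).snd : L2 Ω ℝ)) p)
    {η : ℝ → ℝ} (hη : ContDiff ℝ ∞ η) (hηc : HasCompactSupport η) (hηs : tsupport η ⊆ Ioo 0 T)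
    {χ : V → ℝ} (hχ : ContDiff ℝ ∞ χ) (hχc : HasCompactSupport χ) (hχs : tsupport χ ⊆ Ω) :
    Integrable (fun z : ℝ × V => p z * χ z.2)
      ((volume.restrict (Ioo 0 T)).prod (volume.restrict Ω)) ∧
    Integrable (fun z : ℝ × V => inner ℝ (Matrix.toEuclideanLin D (u z)) (∇ χ z.2))
      ((volume.restrict (Ioo 0 T)).prod (volume.restrict Ω)) ∧
    ∫ t in Ioo 0 T, (deriv η t * (∫ x in Ω, p (t, x) * χ x) +
      η t * (∫ x in Ω, inner ℝ (Matrix.toEuclideanLin D (u (t, x))) (∇ χ x))) = 0 := by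
  have hfin : IsFiniteMeasure (volume.restrict Ω : Measure V) :=
    ⟨by rw [Measure.restrict_apply_univ]; exact hb.lt_top⟩
  have hui : Integrable u ((volume.restrict (Ioo 0 T)).prod (volume.restrict Ω)) := by
    have := (hu.memLp.restrict (Ioo 0 T ×ˢ Ω))
    rw [← restrict_prod_restrict] at this
    exact this.integrable (by norm_num)
  have hDu : Integrable (fun z => Matrix.toEuclideanLin D (u z))
      ((volume.restrict (Ioo 0 T)).prod (volume.restrict Ω)) :=
    (LinearMap.toContinuousLinearMap (Matrix.toEuclideanLin D)).integrable_comp hui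
  have hpi : Integrable p ((volume.restrict (Ioo 0 T)).prod (volume.restrict Ω)) := by
    have := (hp.memLp.restrict (Ioo 0 T ×ˢ Ω))
    rw [← restrict_prod_restrict] at this
    exact this.integrable (by norm_num)
  have hgc : Continuous (∇ χ) :=
    (InnerProductSpace.toDual ℝ V).symm.continuous.comp (hχ.continuous_fderiv (by simp))
  have hgs : HasCompactSupport (∇ χ) := (hχc.fderiv ℝ).comp_left (map_zero _)
  have i1 := integrable_inner_test hpi hχ.continuous hχc
  simp only [real_inner_eq_mul] at i1
  have i2 := integrable_inner_test hDu hgc hgs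
  refine ⟨i1, i2, ?_⟩
  have h := hU.pressure _ (isTest_smul hη hηc hηs hχ hχc hχs)
  rw [← neg_eq_zero, ← integral_neg]
  refine Eq.trans (integral_congr_ae ?_) h
  filter_upwards [hu.ae_eq, hp.ae_eq, i1.prod_right_ae, i2.prod_right_ae] with t hut hpt j1 j2
  rw [← integral_const_mul, ← integral_const_mul,
    ← integral_add (j1.const_mul _) (j2.const_mul _), ← integral_neg]
  refine integral_congr_ae ?_
  filter_upwards [hut, hpt] with x hux hpx
  rw [dt_smul hη, gradient_const_smul _ hχ, ← hux, ← hpx]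
  simp only [inner_smul_right, smul_eq_mul]
  ring

end Slices

/-! ### Pairing with functions of space only -/

section TimeIndependent

variable {Ω : Set V} {F : Type*} [NormedAddCommGroup F] [InnerProductSpace ℝ F] {p q : ENNReal}
  {I : Set ℝ}

lemma MemLp.restrict_cylinder {F : Type*} [NormedAddCommGroup F] {a : ℝ × V → F} (ha : MemLp a p)
    (I : Set ℝ) (Ω : Set V) : MemLp a p ((volume.restrict I).prod (volume.restrict Ω)) := by
  rw [restrict_prod_restrict]
  exact ha.restrict _

/-- The pairing of a space-time function with a function of the space variable is integrable. -/
lemma integrable_inner_snd [ENNReal.HolderTriple p q 1] {a : ℝ × V → F} {b : V → F}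
    (ha : MemLp a p) (hb : MemLp b q (volume.restrict Ω)) (hI : volume I ≠ ⊤) :
    Integrable (fun z : ℝ × V => inner ℝ (a z) (b z.2))
      ((volume.restrict I).prod (volume.restrict Ω)) := by
  have : IsFiniteMeasure (volume.restrict I : Measure ℝ) :=
    ⟨by rw [Measure.restrict_apply_univ]; exact hI.lt_top⟩
  exact integrable_inner_of_memLp (MemLp.restrict_cylinder ha I Ω) (hb.comp_snd _)

/-- On the cylinder, the `L^q` norm of a function of `x` alone is at most its spatial norm times a
power of the length of `I`; spatial convergence therefore suffices for Hölder. -/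
lemma tendsto_integral_inner_snd [ENNReal.HolderTriple p q 1] {a : ℝ × V → F}
    {b : ℕ → V → F} {b₀ : V → F} (ha : MemLp a p) (hb : ∀ n, MemLp (b n) q (volume.restrict Ω))
    (hb₀ : MemLp b₀ q (volume.restrict Ω)) (hI : volume I ≠ ⊤)
    (h : Tendsto (fun n => eLpNorm (fun x => b n x - b₀ x) q (volume.restrict Ω)) atTop (𝓝 0)) :
    Tendsto (fun n => ∫ r in I, ∫ x in Ω, inner ℝ (a (r, x)) (b n x)) atTop
      (𝓝 (∫ r in I, ∫ x in Ω, inner ℝ (a (r, x)) (b₀ x))) := by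
  have : IsFiniteMeasure (volume.restrict I : Measure ℝ) :=
    ⟨by rw [Measure.restrict_apply_univ]; exact hI.lt_top⟩
  have h2 : Tendsto (fun n => eLpNorm (fun z : ℝ × V => b n z.2 - b₀ z.2) q
      ((volume.restrict I).prod (volume.restrict Ω))) atTop (𝓝 0) := by
    have h3 : ∀ n, eLpNorm (fun z : ℝ × V => b n z.2 - b₀ z.2) q
        ((volume.restrict I).prod (volume.restrict Ω)) ≤
        volume I ^ (1 / q).toReal * eLpNorm (fun x => b n x - b₀ x) q (volume.restrict Ω) := by
      intro n
      have hm := ((hb n).sub hb₀).1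
      have e1 : (volume I) • (volume.restrict Ω : Measure V) =
          Measure.map Prod.snd ((volume.restrict I).prod (volume.restrict Ω)) := by
        rw [Measure.map_snd_prod, Measure.restrict_apply_univ]
      have e2 : eLpNorm (fun z : ℝ × V => b n z.2 - b₀ z.2) q
          ((volume.restrict I).prod (volume.restrict Ω)) =
          eLpNorm (fun x => b n x - b₀ x) q ((volume I) • (volume.restrict Ω : Measure V)) := by
        rw [e1, eLpNorm_map_measure (by rw [← e1]; exact hm.smul_measure _) (by fun_prop)]
        rfl
      rw [e2]
      rcases eq_or_ne (volume I) 0 with h0 | h0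
      · simp [h0]
      · rw [eLpNorm_smul_measure_of_ne_zero h0, smul_eq_mul]
    refine tendsto_of_tendsto_of_tendsto_of_le_of_le tendsto_const_nhds ?_ (fun _ => zero_le) h3
    have := ENNReal.Tendsto.const_mul (a := volume I ^ (1 / q).toReal) h
      (Or.inr (ENNReal.rpow_ne_top_of_nonneg ENNReal.toReal_nonneg hI))
    simpa using this
  have h4 := tendsto_integral_inner_right (MemLp.restrict_cylinder ha I Ω)
    (fun n => (hb n).comp_snd (volume.restrict I)) (hb₀.comp_snd (volume.restrict I)) h2
  rw [integral_prod _ (integrable_inner_snd ha hb₀ hI)] at h4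
  refine h4.congr fun n => ?_
  rw [integral_prod _ (integrable_inner_snd ha (hb n) hI)]

end TimeIndependent

lemma SpaceTimeRep.memLp_slice {Ω : Set V} {T : ℝ} {F : Type} [NormedAddCommGroup F]
    [MeasurableSpace F] {v : ℝ → L2 Ω F} {w : ℝ × V → F} (h : SpaceTimeRep Ω T v w) :
    ∀ᵐ t ∂(volume.restrict (Ioo 0 T)), MemLp (fun x => w (t, x)) 2 (volume.restrict Ω) := by
  filter_upwards [h.ae_eq] with t ht
  exact (memLp_congr_ae ht).2 (Lp.memLp _)

/-! ### The difference of two solutions -/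

/-- Jointly measurable representatives of the data attached to a pair of solutions. -/
structure DifferenceReps (Ω : Set V) (T l : ℝ) (f : V → V) (U₁ U₂ : ℝ → E Ω) where
  /-- The first velocity. -/
  u₁ : ℝ × V → V
  /-- The second velocity. -/
  u₂ : ℝ × V → V
  /-- The first pressure. -/
  p₁ : ℝ × V → ℝ
  /-- The second pressure. -/
  p₂ : ℝ × V → ℝ
  /-- The gradient of the difference of the velocities. -/
  grad : ℝ → Fin 3 → L2 Ω V
  /-- A measurable representative of the gradient. -/
  G : Fin 3 → ℝ × V → V
  mem_H10Graph : ∀ᵐ t ∂(volume.restrict (Ioo 0 T)), ((U₁ t).fst - (U₂ t).fst, grad t) ∈ H10Graph Ω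
  rep_u₁ : SpaceTimeRep Ω T (fun t => (U₁ t).fst) u₁
  rep_u₂ : SpaceTimeRep Ω T (fun t => (U₂ t).fst) u₂
  rep_p₁ : SpaceTimeRep Ω T (fun t => ((U₁ t).snd : L2 Ω ℝ)) p₁
  rep_p₂ : SpaceTimeRep Ω T (fun t => ((U₂ t).snd : L2 Ω ℝ)) p₂
  rep_G : ∀ i, SpaceTimeRep Ω T (fun t => grad t i) (G i)
  memLp_u₁ : MemLp u₁ (ENNReal.ofReal (2 * (l + 1)))
  memLp_u₂ : MemLp u₂ (ENNReal.ofReal (2 * (l + 1)))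
  memLp_f₁ : MemLp (fun z => f (u₁ z)) (ENNReal.ofReal (2 * (l + 1) / (2 * l + 1)))
  memLp_f₂ : MemLp (fun z => f (u₂ z)) (ENNReal.ofReal (2 * (l + 1) / (2 * l + 1)))

lemma nonempty_differenceReps {Ω : Set V} (hΩ : IsOpen Ω) (hb : volume Ω ≠ ⊤) {T l : ℝ} (hT : 0 < T)
    {f : V → V} (hf : IsNonlinearity l f) {D : Matrix (Fin 3) (Fin 3) ℝ} {g : L2 Ω V}
    {U₁ U₂ : ℝ → E Ω} (h₁ : IsWeakEnergySolution Ω T l f D g U₁)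
    (h₂ : IsWeakEnergySolution Ω T l f D g U₂) : Nonempty (DifferenceReps Ω T l f U₁ U₂) := by
  obtain ⟨G₁, u₁, p₁, Gu₁, a1, a2, a3, a4, a5⟩ := h₁.exists_spaceTimeRep hΩ hb hT hf.1.1
  obtain ⟨G₂, u₂, p₂, Gu₂, b1, b2, b3, b4, b5⟩ := h₂.exists_spaceTimeRep hΩ hb hT hf.1.1
  have hcyl : MeasurableSet (Ioo 0 T ×ˢ Ω) := measurableSet_Ioo.prod hΩ.measurableSet
  have hfin : volume (Ioo 0 T ×ˢ Ω) ≠ ⊤ := by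
    rw [Measure.volume_eq_prod, Measure.prod_prod]
    exact ENNReal.mul_ne_top measure_Ioo_lt_top.ne hb
  refine ⟨⟨u₁, u₂, p₁, p₂, fun t i => G₁ t i - G₂ t i, fun i z => Gu₁ i z - Gu₂ i z, ?_, a2, b2, a3,
    b3, fun i => (a4 i).sub (b4 i), a5, b5, hf.memLp_comp a2.measurable hcyl hfin a2.eq_zero a5,
    hf.memLp_comp b2.measurable hcyl hfin b2.eq_zero b5⟩⟩
  filter_upwards [a1, b1] with t k1 k2
  exact sub_mem_H10Graph k1 k2

namespace DifferenceReps

variable {Ω : Set V} {T l : ℝ} {f : V → V} {U₁ U₂ : ℝ → E Ω}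

/-- The difference of the velocities. -/
def w (R : DifferenceReps Ω T l f U₁ U₂) (z : ℝ × V) : V := R.u₁ z - R.u₂ z

/-- The difference of the pressures. -/
def q (R : DifferenceReps Ω T l f U₁ U₂) (z : ℝ × V) : ℝ := R.p₁ z - R.p₂ z

/-- The difference of the nonlinear terms. -/
def h (R : DifferenceReps Ω T l f U₁ U₂) (z : ℝ × V) : V := f (R.u₁ z) - f (R.u₂ z)

/-- The columns of the stress tensor `q I - ∇w`. -/
def S (R : DifferenceReps Ω T l f U₁ U₂) (i : Fin 3) (z : ℝ × V) : V := R.q z • e i - R.G i z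

/-- The divergence of `D w`. -/
def d (R : DifferenceReps Ω T l f U₁ U₂) (D : Matrix (Fin 3) (Fin 3) ℝ) (z : ℝ × V) : ℝ :=
  ∑ i, inner ℝ (R.G i z) (WithLp.toLp 2 (D i))

variable (R : DifferenceReps Ω T l f U₁ U₂)

lemma rep_w : SpaceTimeRep Ω T (fun t => (U₁ t).fst - (U₂ t).fst) R.w := R.rep_u₁.sub R.rep_u₂

lemma rep_q : SpaceTimeRep Ω T (fun t => ((U₁ t).snd : L2 Ω ℝ) - ((U₂ t).snd : L2 Ω ℝ)) R.q :=
  R.rep_p₁.sub R.rep_p₂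

lemma memLp_w : MemLp R.w (ENNReal.ofReal (2 * (l + 1))) := R.memLp_u₁.sub R.memLp_u₂

lemma memLp_h : MemLp R.h (ENNReal.ofReal (2 * (l + 1) / (2 * l + 1))) := R.memLp_f₁.sub R.memLp_f₂

lemma memLp_S (i : Fin 3) : MemLp (R.S i) 2 := by
  refine MemLp.sub ?_ (R.rep_G i).memLp
  exact (ContinuousLinearMap.smulRight (ContinuousLinearMap.id ℝ ℝ) (e i)).comp_memLp' R.rep_q.memLp

lemma memLp_d (D : Matrix (Fin 3) (Fin 3) ℝ) : MemLp (R.d D) 2 :=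
  memLp_finsetSum _ fun i _ => (R.rep_G i).memLp.inner_const _

lemma measurable_S (i : Fin 3) : Measurable (R.S i) :=
  (R.rep_q.measurable.smul_const (e i)).sub (R.rep_G i).measurable

lemma measurable_d (D : Matrix (Fin 3) (Fin 3) ℝ) : Measurable (R.d D) :=
  Finset.measurable_fun_sum _ fun i _ => (R.rep_G i).measurable.inner_const

end DifferenceReps

lemma inner_toLp_eq_integral {Ω : Set V} {F : Type} [NormedAddCommGroup F] [InnerProductSpace ℝ F]
    (v : L2 Ω F) {g : V → F} (hg : MemLp g 2 (volume.restrict Ω)) :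
    inner ℝ (hg.toLp g) v = ∫ y in Ω, inner ℝ (v y) (g y) := by
  rw [L2.inner_def]
  refine integral_congr_ae ?_
  filter_upwards [hg.coeFn_toLp] with y hy
  rw [hy, real_inner_comm]

lemma one_le_conjugate_exponent {l : ℝ} (hl : 0 < l) :
    1 ≤ ENNReal.ofReal (2 * (l + 1) / (2 * l + 1)) := by
  rw [← ENNReal.ofReal_one]
  refine ENNReal.ofReal_le_ofReal ?_
  rw [le_div_iff₀ (by linarith)]
  linarith

/-- Sobolev embedding for `H¹₀`, at the exponents of the nonlinearity. -/
lemma memLp_of_mem_H10Graph {Ω : Set V} (hbd : Bornology.IsBounded Ω) {l : ℝ} (hl : l ∈ Ioc 0 2)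
    {v : L2 Ω V × (Fin 3 → L2 Ω V)} (hv : v ∈ H10Graph Ω) :
    MemLp v.1 (ENNReal.ofReal (2 * (l + 1))) (volume.restrict Ω) := by
  obtain ⟨C, hC⟩ := exists_eLpNorm_le_of_mem_H10Graph hbd (q := (2 * (l + 1)).toNNReal)
    (by simp; linarith [hl.1]) (by
      rw [Real.toNNReal_le_iff_le_coe]; norm_num; linarith [hl.2])
  exact ⟨Lp.aestronglyMeasurable _, (hC v hv).trans_lt
    (ENNReal.mul_lt_top ENNReal.coe_lt_top enorm_lt_top)⟩

/-- `f(u)` grows like `‖u‖^(2l+1)`, so it sits in the dual of `L^{2(l+1)}`; this duality is what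
pairs it with `H¹₀` fields. -/
lemma holderConjugate_exponents {l : ℝ} (hl : 0 < l) :
    ENNReal.HolderConjugate (ENNReal.ofReal (2 * (l + 1) / (2 * l + 1)))
      (ENNReal.ofReal (2 * (l + 1))) := by
  refine Real.HolderConjugate.ennrealOfReal ?_
  rw [Real.holderConjugate_iff]
  have h1 : (0 : ℝ) < 2 * l + 1 := by linarith
  have h2 : (0 : ℝ) < l + 1 := by linarith
  constructor
  · rw [lt_div_iff₀ h1]; linarith
  · field_simp
    ring

/-! ### Time increments of the difference -/

namespace DifferenceReps

variable {Ω : Set V} {T l : ℝ} {f : V → V} {D : Matrix (Fin 3) (Fin 3) ℝ} {g : L2 Ω V}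
  {U₁ U₂ : ℝ → E Ω} (R : DifferenceReps Ω T l f U₁ U₂)

/-- The increment of the velocity difference, tested with a smooth field. -/
theorem momentum_increment_test (hb : volume Ω ≠ ⊤) (hT : 0 < T) (hl : 0 < l)
    (h₁ : IsWeakEnergySolution Ω T l f D g U₁) (h₂ : IsWeakEnergySolution Ω T l f D g U₂)
    {φ : V → V} (hφ : ContDiff ℝ ∞ φ) (hφc : HasCompactSupport φ) (hφs : tsupport φ ⊆ Ω)
    {s t : ℝ} (hs : 0 ≤ s) (hst : s ≤ t) (ht : t ≤ T) :
    (∫ x in Ω, inner ℝ (((U₁ t).fst - (U₂ t).fst : L2 Ω V) x) (φ x)) -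
      (∫ x in Ω, inner ℝ (((U₁ s).fst - (U₂ s).fst : L2 Ω V) x) (φ x)) =
    ∫ r in s..t, ((∑ i, ∫ x in Ω, inner ℝ (R.S i (r, x)) (fderiv ℝ φ x (e i))) -
      ∫ x in Ω, inner ℝ (R.h (r, x)) (φ x)) := by
  have hfin : IsFiniteMeasure (volume.restrict Ω : Measure V) :=
    ⟨by rw [Measure.restrict_apply_univ]; exact hb.lt_top⟩
  have hconj := holderConjugate_exponents hl
  have hφ2 : MemLp φ 2 (volume.restrict Ω) :=
    (hφ.continuous.memLp_of_hasCompactSupport hφc).restrict Ω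
  have hφq : MemLp φ (ENNReal.ofReal (2 * (l + 1))) (volume.restrict Ω) :=
    (hφ.continuous.memLp_of_hasCompactSupport hφc).restrict Ω
  have hζ : ∀ i, ContDiff ℝ ∞ fun y => fderiv ℝ φ y (e i) := fun i => contDiff_fderiv_apply hφ (e i)
  have hζc : ∀ i, HasCompactSupport fun y => fderiv ℝ φ y (e i) := fun i => hφc.fderiv_apply ℝ (e i)
  have hζ2 : ∀ i, MemLp (fun y => fderiv ℝ φ y (e i)) 2 (volume.restrict Ω) := fun i =>
    ((hζ i).continuous.memLp_of_hasCompactSupport (hζc i)).restrict Ω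
  have hIoo : volume (Ioo 0 T) ≠ ⊤ := measure_Ioo_lt_top.ne
  have hp1 := one_le_conjugate_exponent hl
  refine sub_eq_integral_of_distributional_deriv hT
    (c := fun t => ∫ x in Ω, inner ℝ (((U₁ t).fst - (U₂ t).fst : L2 Ω V) x) (φ x)) ?_ ?_ ?_ hs hst ht
  · simp_rw [← inner_toLp_eq_integral _ hφ2, inner_sub_right]
    exact (continuousOn_inner_fst h₁.weakly_continuous _).sub
      (continuousOn_inner_fst h₂.weakly_continuous _)
  · refine Integrable.sub (integrable_finsetSum _ fun i _ => ?_) ?_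
    · exact (integrable_inner_snd (R.memLp_S i) (hζ2 i) hIoo).integral_prod_left
    · exact (integrable_inner_snd R.memLp_h hφq hIoo).integral_prod_left
  · intro η hη hηc hηs
    have hf₁ : Integrable (fun z => f (R.u₁ z))
        ((volume.restrict (Ioo 0 T)).prod (volume.restrict Ω)) :=
      have : IsFiniteMeasure (volume.restrict (Ioo 0 T) : Measure ℝ) := inferInstance
      (MemLp.restrict_cylinder R.memLp_f₁ _ _).integrable hp1
    have hf₂ : Integrable (fun z => f (R.u₂ z))
        ((volume.restrict (Ioo 0 T)).prod (volume.restrict Ω)) :=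
      (MemLp.restrict_cylinder R.memLp_f₂ _ _).integrable hp1
    obtain ⟨i1, i2, i3⟩ := h₁.momentum_product hb R.rep_u₁ R.rep_p₁ hf₁ hη hηc hηs hφ hφc hφs
    obtain ⟨j1, j2, j3⟩ := h₂.momentum_product hb R.rep_u₂ R.rep_p₂ hf₂ hη hηc hηs hφ hφc hφs
    obtain ⟨M, hM⟩ := hηc.exists_bound_of_continuous hη.continuous
    obtain ⟨M', hM'⟩ := hηc.deriv.exists_bound_of_continuous (hη.continuous_deriv (by simp))
    have bd : ∀ {a b : ℝ → ℝ}, IntegrableOn a (Ioo 0 T) → IntegrableOn b (Ioo 0 T) →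
        IntegrableOn (fun t => deriv η t * a t + η t * b t) (Ioo 0 T) := fun ha hb =>
      (ha.bdd_mul (hη.continuous_deriv (by simp)).aestronglyMeasurable (.of_forall hM')).add
        (hb.bdd_mul hη.continuous.aestronglyMeasurable (.of_forall hM))
    have key := (integral_sub (bd i1.integral_prod_left i2.integral_prod_left)
      (bd j1.integral_prod_left j2.integral_prod_left))
    rw [i3, j3, sub_zero] at key
    refine Eq.trans (integral_congr_ae ?_) key
    filter_upwards [R.mem_H10Graph, R.rep_w.ae_eq, ae_all_iff.2 fun i => (R.rep_G i).ae_eq,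
      R.rep_q.memLp_slice, R.rep_w.memLp_slice, ae_all_iff.2 fun i => (R.rep_G i).memLp_slice,
      i1.prod_right_ae, i2.prod_right_ae, j1.prod_right_ae, j2.prod_right_ae,
      (integrable_inner_snd R.memLp_h hφq hIoo).prod_right_ae]
      with r hH hwr hGr hq2 hw2 hG2 k1 k2 k3 k4 kh
    have e1 : ∫ x in Ω, inner ℝ (((U₁ r).fst - (U₂ r).fst : L2 Ω V) x) (φ x) =
        (∫ x in Ω, inner ℝ (R.u₁ (r, x)) (φ x)) - ∫ x in Ω, inner ℝ (R.u₂ (r, x)) (φ x) := by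
      rw [← integral_sub k1 k3]
      refine integral_congr_ae ?_
      filter_upwards [hwr] with x hx
      rw [← hx, ← inner_sub_left]; rfl
    have hζζ2 : ∀ i, MemLp (fun y => fderiv ℝ (fun y => fderiv ℝ φ y (e i)) y (e i)) 2
        (volume.restrict Ω) := fun i =>
      ((contDiff_fderiv_apply (hζ i) (e i)).continuous.memLp_of_hasCompactSupport
        ((hζc i).fderiv_apply ℝ (e i))).restrict Ω
    have hqe : ∀ i, MemLp (fun x => R.q (r, x) • e i) 2 (volume.restrict Ω) := fun i =>
      (ContinuousLinearMap.smulRight (ContinuousLinearMap.id ℝ ℝ) (e i)).comp_memLp' hq2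
    -- Almost every slice of `w` lies in `H¹₀`, so one derivative of the Laplacian can be moved onto
    -- it.
    have e2 : ∀ i, ∫ x in Ω, inner ℝ (R.w (r, x)) (fderiv ℝ (fun y => fderiv ℝ φ y (e i)) x (e i)) =
        -∫ x in Ω, inner ℝ (R.G i (r, x)) (fderiv ℝ φ x (e i)) := by
      intro i
      have := integral_inner_fderiv_of_mem_H10Graph hH ((hζ i).of_le (by exact_mod_cast le_top))
        (hζc i) i
      refine Eq.trans (integral_congr_ae ?_) (this.trans (congrArg _ (integral_congr_ae ?_)))
      · filter_upwards [hwr] with x hx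
        rw [← hx]
      · filter_upwards [hGr i] with x hx
        rw [← hx]
    -- The forcing `g` cancels, and the pressure and Laplacian terms merge into the pairing of the
    -- columns of `q I - ∇w` with the derivatives of `φ`.
    have e3 : (∑ i, ∫ x in Ω, inner ℝ (R.S i (r, x)) (fderiv ℝ φ x (e i))) -
        (∫ x in Ω, inner ℝ (R.h (r, x)) (φ x)) =
        (∫ x in Ω, (inner ℝ (R.u₁ (r, x)) (Laplacian.laplacian φ x) +
          R.p₁ (r, x) * divergence φ x - inner ℝ (f (R.u₁ (r, x))) (φ x) + inner ℝ (g x) (φ x))) -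
        ∫ x in Ω, (inner ℝ (R.u₂ (r, x)) (Laplacian.laplacian φ x) +
          R.p₂ (r, x) * divergence φ x - inner ℝ (f (R.u₂ (r, x))) (φ x) + inner ℝ (g x) (φ x)) := by
      have m1 : ∀ i, Integrable (fun x => inner ℝ (R.q (r, x) • e i) (fderiv ℝ φ x (e i)))
          (volume.restrict Ω) := fun i => integrable_inner_of_memLp (hqe i) (hζ2 i)
      have m2 : ∀ i, Integrable (fun x => inner ℝ (R.G i (r, x)) (fderiv ℝ φ x (e i)))
          (volume.restrict Ω) := fun i => integrable_inner_of_memLp (hG2 i) (hζ2 i)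
      have m3 : ∀ i, Integrable (fun x => inner ℝ (R.w (r, x))
          (fderiv ℝ (fun y => fderiv ℝ φ y (e i)) x (e i))) (volume.restrict Ω) := fun i =>
        integrable_inner_of_memLp hw2 (hζζ2 i)
      have m4 : ∀ i, ∫ x in Ω, inner ℝ (R.S i (r, x)) (fderiv ℝ φ x (e i)) =
          ∫ x in Ω, (inner ℝ (R.q (r, x) • e i) (fderiv ℝ φ x (e i)) +
            inner ℝ (R.w (r, x)) (fderiv ℝ (fun y => fderiv ℝ φ y (e i)) x (e i))) := by
        intro i
        rw [integral_add (m1 i) (m3 i), e2 i, ← sub_eq_add_neg, ← integral_sub (m1 i) (m2 i)]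
        simp_rw [← inner_sub_left]; rfl
      have m5 : ∀ i, Integrable (fun x => inner ℝ (R.q (r, x) • e i) (fderiv ℝ φ x (e i)) +
          inner ℝ (R.w (r, x)) (fderiv ℝ (fun y => fderiv ℝ φ y (e i)) x (e i)))
          (volume.restrict Ω) := fun i => (m1 i).add (m3 i)
      simp_rw [m4]
      rw [← integral_finsetSum _ (fun i _ => m5 i), ← integral_sub
        (integrable_finsetSum _ fun i _ => m5 i) kh, ← integral_sub k2 k4]
      refine integral_congr_ae (.of_forall fun x => ?_)
      simp only [laplacian_eq_sum hφ, divergence, w, q, h, Finset.sum_add_distrib, inner_sub_left,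
        inner_sum, real_inner_smul_left, sub_mul, Finset.mul_sum, Finset.sum_sub_distrib]
      simp only [PiLp.inner_apply, PiLp.single_apply, RCLike.inner_apply, conj_trivial]
      simp
      ring
    rw [e1, e3]
    ring

/-- The increment of the velocity difference, tested with a field in `H¹₀`. -/
theorem momentum_increment (hbd : Bornology.IsBounded Ω) (hT : 0 < T) (hl : l ∈ Ioc 0 2)
    (h₁ : IsWeakEnergySolution Ω T l f D g U₁) (h₂ : IsWeakEnergySolution Ω T l f D g U₂)
    {v : L2 Ω V × (Fin 3 → L2 Ω V)} (hv : v ∈ H10Graph Ω)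
    {s t : ℝ} (hs : 0 ≤ s) (hst : s ≤ t) (ht : t ≤ T) :
    inner ℝ (((U₁ t).fst - (U₂ t).fst) - ((U₁ s).fst - (U₂ s).fst)) v.1 =
      (∑ i, ∫ r in Ioc s t, ∫ x in Ω, inner ℝ (R.S i (r, x)) (v.2 i x)) -
      ∫ r in Ioc s t, ∫ x in Ω, inner ℝ (R.h (r, x)) (v.1 x) := by
  have hb : volume Ω ≠ ⊤ := hbd.measure_lt_top.ne
  have hconj := holderConjugate_exponents hl.1
  have hIoc : volume (Ioc s t) ≠ ⊤ := measure_Ioc_lt_top.ne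
  obtain ⟨C, hC⟩ := exists_eLpNorm_le_of_mem_H10Graph hbd (q := (2 * (l + 1)).toNNReal)
    (by simp; linarith [hl.1]) (by
      rw [Real.toNNReal_le_iff_le_coe]; norm_num; linarith [hl.2])
  have hq : ∀ z ∈ H10Graph Ω, MemLp z.1 (ENNReal.ofReal (2 * (l + 1))) (volume.restrict Ω) :=
    fun z hz => memLp_of_mem_H10Graph hbd hl hz
  obtain ⟨z, hz, hlim⟩ := mem_closure_iff_seq_limit.1 hv
  have hzH : ∀ n, z n ∈ H10Graph Ω := fun n => subset_closure (hz n)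
  have hlim1 : Tendsto (fun n => (z n).1) atTop (𝓝 v.1) := (continuous_fst.tendsto _).comp hlim
  have hlim2 : ∀ i, Tendsto (fun n => (z n).2 i) atTop (𝓝 (v.2 i)) := fun i =>
    (((continuous_apply i).comp continuous_snd).tendsto _).comp hlim
  have htest : ∀ n, inner ℝ (((U₁ t).fst - (U₂ t).fst) - ((U₁ s).fst - (U₂ s).fst)) (z n).1 =
      (∑ i, ∫ r in Ioc s t, ∫ x in Ω, inner ℝ (R.S i (r, x)) ((z n).2 i x)) -
      ∫ r in Ioc s t, ∫ x in Ω, inner ℝ (R.h (r, x)) ((z n).1 x) := by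
    intro n
    obtain ⟨φ, k1, k2, k3, k4, k5⟩ := hz n
    have key := R.momentum_increment_test hb hT hl.1 h₁ h₂ k1 k2 k3 hs hst ht
    have c1 : ∀ a : L2 Ω V, ∫ x in Ω, inner ℝ (a x) (φ x) = inner ℝ a (z n).1 := by
      intro a
      rw [L2.inner_def]
      refine integral_congr_ae ?_
      filter_upwards [k4] with x hx
      rw [hx]
    have c2 : ∀ r i, ∫ x in Ω, inner ℝ (R.S i (r, x)) (fderiv ℝ φ x (e i)) =
        ∫ x in Ω, inner ℝ (R.S i (r, x)) ((z n).2 i x) := by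
      intro r i
      refine integral_congr_ae ?_
      filter_upwards [k5 i] with x hx
      rw [hx]
    have c3 : ∀ r, ∫ x in Ω, inner ℝ (R.h (r, x)) (φ x) =
        ∫ x in Ω, inner ℝ (R.h (r, x)) ((z n).1 x) := by
      intro r
      refine integral_congr_ae ?_
      filter_upwards [k4] with x hx
      rw [hx]
    have i1 : ∀ i, IntegrableOn (fun r => ∫ x in Ω, inner ℝ (R.S i (r, x)) ((z n).2 i x))
        (Ioc s t) := fun i =>
      (integrable_inner_snd (R.memLp_S i) (Lp.memLp ((z n).2 i)) hIoc).integral_prod_left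
    have i2 : IntegrableOn (fun r => ∫ x in Ω, inner ℝ (R.h (r, x)) ((z n).1 x)) (Ioc s t) :=
      (integrable_inner_snd R.memLp_h (hq _ (hzH n)) hIoc).integral_prod_left
    rw [c1, c1, ← inner_sub_left, intervalIntegral.integral_of_le hst] at key
    simp_rw [c2, c3] at key
    rwa [integral_sub (integrable_finsetSum _ fun i _ => i1 i) i2,
      integral_finsetSum _ fun i _ => i1 i] at key
  have L1 : Tendsto (fun n => inner ℝ (((U₁ t).fst - (U₂ t).fst) - ((U₁ s).fst - (U₂ s).fst))
      (z n).1) atTop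
      (𝓝 (inner ℝ (((U₁ t).fst - (U₂ t).fst) - ((U₁ s).fst - (U₂ s).fst)) v.1)) :=
    tendsto_const_nhds.inner hlim1
  have L2' : ∀ i, Tendsto (fun n => ∫ r in Ioc s t, ∫ x in Ω, inner ℝ (R.S i (r, x)) ((z n).2 i x))
      atTop (𝓝 (∫ r in Ioc s t, ∫ x in Ω, inner ℝ (R.S i (r, x)) (v.2 i x))) := fun i =>
    tendsto_integral_inner_snd (R.memLp_S i) (fun n => Lp.memLp _) (Lp.memLp _) hIoc
      ((Lp.tendsto_Lp_iff_tendsto_eLpNorm' _ _).1 (hlim2 i))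
  -- The nonlinear term needs convergence in `L^{2(l+1)}`, which follows from the Sobolev bound
  -- applied to `z n - v`.
  have L3 : Tendsto (fun n => ∫ r in Ioc s t, ∫ x in Ω, inner ℝ (R.h (r, x)) ((z n).1 x))
      atTop (𝓝 (∫ r in Ioc s t, ∫ x in Ω, inner ℝ (R.h (r, x)) (v.1 x))) := by
    refine tendsto_integral_inner_snd R.memLp_h (fun n => hq _ (hzH n)) (hq _ hv) hIoc ?_
    have hsub : Tendsto (fun n => (C : ENNReal) * ‖(z n).2 - v.2‖ₑ) atTop (𝓝 0) := by
      have h0 := ((((continuous_snd.tendsto v).comp hlim)).sub_const v.2).enorm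
      rw [sub_self, enorm_zero] at h0
      simpa using ENNReal.Tendsto.const_mul (a := (C : ENNReal)) h0 (Or.inr ENNReal.coe_ne_top)
    refine tendsto_of_tendsto_of_tendsto_of_le_of_le tendsto_const_nhds hsub (fun _ => zero_le)
      fun n => ?_
    have h1 := hC _ (sub_mem_H10Graph (hzH n) hv)
    rw [Prod.fst_sub, Prod.snd_sub, eLpNorm_congr_ae (Lp.coeFn_sub (z n).1 v.1)] at h1
    exact h1
  exact tendsto_nhds_unique (L1.congr htest) ((tendsto_finsetSum _ fun i _ => L2' i).sub L3)

end DifferenceReps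

/-- Sorting by rows of `D` lets each direction be integrated by parts separately, leading to
`div(Dw) = ∑ᵢ ∂ᵢw · Dᵢ`, the form used in `DifferenceReps.d`. -/
lemma inner_toEuclideanLin_gradient (D : Matrix (Fin 3) (Fin 3) ℝ) (v : V) (χ : V → ℝ) (x : V) :
    inner ℝ (Matrix.toEuclideanLin D v) (∇ χ x) =
      ∑ i, fderiv ℝ χ x (e i) * inner ℝ v (WithLp.toLp 2 (D i)) := by
  have h1 : ∀ i, fderiv ℝ χ x (e i) = (∇ χ x) i := by
    intro i
    have : fderiv ℝ χ x (e i) = inner ℝ (∇ χ x) (e i) := by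
      unfold gradient
      rw [InnerProductSpace.toDual_symm_apply]
    rw [this]
    simpa only [conj_trivial, one_mul] using EuclideanSpace.inner_single_right i (1 : ℝ) (∇ χ x)
  rw [PiLp.inner_apply]
  refine Finset.sum_congr rfl fun i _ => ?_
  rw [h1]
  simp [PiLp.inner_apply, Matrix.mulVec, dotProduct, Matrix.toLpLin_apply]

namespace DifferenceReps

variable {Ω : Set V} {T l : ℝ} {f : V → V} {D : Matrix (Fin 3) (Fin 3) ℝ} {g : L2 Ω V}
  {U₁ U₂ : ℝ → E Ω} (R : DifferenceReps Ω T l f U₁ U₂)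

/-- The increment of the pressure difference, tested with a smooth function. -/
theorem pressure_increment_test (hb : volume Ω ≠ ⊤) (hT : 0 < T)
    (h₁ : IsWeakEnergySolution Ω T l f D g U₁) (h₂ : IsWeakEnergySolution Ω T l f D g U₂)
    {χ : V → ℝ} (hχ : ContDiff ℝ ∞ χ) (hχc : HasCompactSupport χ) (hχs : tsupport χ ⊆ Ω)
    {s t : ℝ} (hs : 0 ≤ s) (hst : s ≤ t) (ht : t ≤ T) :
    (∫ x in Ω, inner ℝ ((((U₁ t).snd : L2 Ω ℝ) - ((U₂ t).snd : L2 Ω ℝ) : L2 Ω ℝ) x) (χ x)) -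
      (∫ x in Ω, inner ℝ ((((U₁ s).snd : L2 Ω ℝ) - ((U₂ s).snd : L2 Ω ℝ) : L2 Ω ℝ) x) (χ x)) =
    ∫ r in s..t, -∫ x in Ω, inner ℝ (R.d D (r, x)) (χ x) := by
  have hfin : IsFiniteMeasure (volume.restrict Ω : Measure V) :=
    ⟨by rw [Measure.restrict_apply_univ]; exact hb.lt_top⟩
  have hχ2 : MemLp χ 2 (volume.restrict Ω) :=
    (hχ.continuous.memLp_of_hasCompactSupport hχc).restrict Ω
  have hIoo : volume (Ioo 0 T) ≠ ⊤ := measure_Ioo_lt_top.ne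
  refine sub_eq_integral_of_distributional_deriv hT
    (c := fun t => ∫ x in Ω,
      inner ℝ ((((U₁ t).snd : L2 Ω ℝ) - ((U₂ t).snd : L2 Ω ℝ) : L2 Ω ℝ) x) (χ x)) ?_ ?_ ?_ hs hst ht
  · simp_rw [← inner_toLp_eq_integral _ hχ2, inner_sub_right]
    exact (continuousOn_inner_snd hb h₁.weakly_continuous _).sub
      (continuousOn_inner_snd hb h₂.weakly_continuous _)
  · exact (integrable_inner_snd (R.memLp_d D) hχ2 hIoo).integral_prod_left.neg
  · intro η hη hηc hηs
    obtain ⟨i1, i2, i3⟩ := h₁.pressure_product hb R.rep_u₁ R.rep_p₁ hη hηc hηs hχ hχc hχs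
    obtain ⟨j1, j2, j3⟩ := h₂.pressure_product hb R.rep_u₂ R.rep_p₂ hη hηc hηs hχ hχc hχs
    obtain ⟨M, hM⟩ := hηc.exists_bound_of_continuous hη.continuous
    obtain ⟨M', hM'⟩ := hηc.deriv.exists_bound_of_continuous (hη.continuous_deriv (by simp))
    have bd : ∀ {a b : ℝ → ℝ}, IntegrableOn a (Ioo 0 T) → IntegrableOn b (Ioo 0 T) →
        IntegrableOn (fun t => deriv η t * a t + η t * b t) (Ioo 0 T) := fun ha hb =>
      (ha.bdd_mul (hη.continuous_deriv (by simp)).aestronglyMeasurable (.of_forall hM')).add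
        (hb.bdd_mul hη.continuous.aestronglyMeasurable (.of_forall hM))
    have key := (integral_sub (bd i1.integral_prod_left i2.integral_prod_left)
      (bd j1.integral_prod_left j2.integral_prod_left))
    rw [i3, j3, sub_zero] at key
    refine Eq.trans (integral_congr_ae ?_) key
    filter_upwards [R.mem_H10Graph, R.rep_w.ae_eq, ae_all_iff.2 fun i => (R.rep_G i).ae_eq,
      R.rep_q.ae_eq, R.rep_w.memLp_slice, ae_all_iff.2 fun i => (R.rep_G i).memLp_slice,
      i1.prod_right_ae, i2.prod_right_ae, j1.prod_right_ae, j2.prod_right_ae]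
      with r hH hwr hGr hqr hw2 hG2 k1 k2 k3 k4
    have e1 : ∫ x in Ω, inner ℝ
        ((((U₁ r).snd : L2 Ω ℝ) - ((U₂ r).snd : L2 Ω ℝ) : L2 Ω ℝ) x) (χ x) =
        (∫ x in Ω, R.p₁ (r, x) * χ x) - ∫ x in Ω, R.p₂ (r, x) * χ x := by
      rw [← integral_sub k1 k3]
      refine integral_congr_ae ?_
      filter_upwards [hqr] with x hx
      rw [← hx, real_inner_eq_mul, ← sub_mul]; rfl
    have hζ : ∀ i : Fin 3, ContDiff ℝ 1 fun y => χ y • (WithLp.toLp 2 (D i) : V) := fun i =>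
      (hχ.of_le (by exact_mod_cast le_top)).smul contDiff_const
    have hζc : ∀ i : Fin 3, HasCompactSupport fun y => χ y • (WithLp.toLp 2 (D i) : V) := fun i =>
      hχc.smul_right
    have hζd : ∀ (i : Fin 3) (x : V), fderiv ℝ (fun y => χ y • (WithLp.toLp 2 (D i) : V)) x (e i) =
        fderiv ℝ χ x (e i) • (WithLp.toLp 2 (D i) : V) := by
      intro i x
      rw [fderiv_smul_const (hχ.differentiable (by simp) x)]
      simp
    have hζ2 : ∀ i : Fin 3, MemLp (fun y => χ y • (WithLp.toLp 2 (D i) : V)) 2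
        (volume.restrict Ω) := fun i =>
      ((hζ i).continuous.memLp_of_hasCompactSupport (hζc i)).restrict Ω
    have hχd2 : ∀ i : Fin 3, MemLp (fun y => fderiv ℝ χ y (e i)) 2 (volume.restrict Ω) := fun i =>
      ((contDiff_fderiv_apply hχ (e i)).continuous.memLp_of_hasCompactSupport
        (hχc.fderiv_apply ℝ (e i))).restrict Ω
    have hζd2 : ∀ i : Fin 3, MemLp (fun y => fderiv ℝ χ y (e i) • (WithLp.toLp 2 (D i) : V)) 2
        (volume.restrict Ω) := fun i =>
      (ContinuousLinearMap.smulRight (ContinuousLinearMap.id ℝ ℝ)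
        (WithLp.toLp 2 (D i) : V)).comp_memLp' (hχd2 i)
    have e2 : ∀ i : Fin 3,
        ∫ x in Ω, inner ℝ (R.w (r, x)) (fderiv ℝ χ x (e i) • (WithLp.toLp 2 (D i) : V)) =
        -∫ x in Ω, inner ℝ (R.G i (r, x)) (χ x • (WithLp.toLp 2 (D i) : V)) := by
      intro i
      have := integral_inner_fderiv_of_mem_H10Graph hH (hζ i) (hζc i) i
      simp_rw [hζd] at this
      refine Eq.trans (integral_congr_ae ?_) (this.trans (congrArg _ (integral_congr_ae ?_)))
      · filter_upwards [hwr] with x hx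
        rw [← hx]
      · filter_upwards [hGr i] with x hx
        rw [← hx]
    have e3 : -(∫ x in Ω, inner ℝ (R.d D (r, x)) (χ x)) =
        (∫ x in Ω, inner ℝ (Matrix.toEuclideanLin D (R.u₁ (r, x))) (∇ χ x)) -
        ∫ x in Ω, inner ℝ (Matrix.toEuclideanLin D (R.u₂ (r, x))) (∇ χ x) := by
      have m1 : ∀ i : Fin 3, Integrable (fun x =>
          inner ℝ (R.G i (r, x)) (χ x • (WithLp.toLp 2 (D i) : V))) (volume.restrict Ω) := fun i =>
        integrable_inner_of_memLp (hG2 i) (hζ2 i)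
      have m2 : ∀ i : Fin 3, Integrable (fun x =>
          inner ℝ (R.w (r, x)) (fderiv ℝ χ x (e i) • (WithLp.toLp 2 (D i) : V)))
          (volume.restrict Ω) := fun i => integrable_inner_of_memLp hw2 (hζd2 i)
      have m3 : ∫ x in Ω, inner ℝ (R.d D (r, x)) (χ x) =
          ∑ i, ∫ x in Ω, inner ℝ (R.G i (r, x)) (χ x • (WithLp.toLp 2 (D i) : V)) := by
        rw [← integral_finsetSum _ fun i _ => m1 i]
        refine integral_congr_ae (.of_forall fun x => ?_)
        simp only [d, real_inner_eq_mul, Finset.sum_mul, real_inner_smul_right]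
        exact Finset.sum_congr rfl fun i _ => mul_comm _ _
      rw [m3, ← Finset.sum_neg_distrib]
      simp_rw [← e2]
      rw [← integral_finsetSum _ fun i _ => m2 i, ← integral_sub k2 k4]
      refine integral_congr_ae (.of_forall fun x => ?_)
      simp only [← inner_sub_left, ← map_sub]
      rw [inner_toEuclideanLin_gradient]
      simp only [real_inner_smul_right]
      rfl
    rw [e1, e3]
    ring

/-- The increment of the pressure difference, tested with a square integrable function. -/
theorem pressure_increment (hΩ : IsOpen Ω) (hb : volume Ω ≠ ⊤) (hT : 0 < T)
    (h₁ : IsWeakEnergySolution Ω T l f D g U₁) (h₂ : IsWeakEnergySolution Ω T l f D g U₂)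
    (χ : L2 Ω ℝ) {s t : ℝ} (hs : 0 ≤ s) (hst : s ≤ t) (ht : t ≤ T) :
    inner ℝ ((((U₁ t).snd : L2 Ω ℝ) - ((U₂ t).snd : L2 Ω ℝ)) -
      (((U₁ s).snd : L2 Ω ℝ) - ((U₂ s).snd : L2 Ω ℝ))) χ =
      -∫ r in Ioc s t, ∫ x in Ω, inner ℝ (R.d D (r, x)) (χ x) := by
  have hfin : IsFiniteMeasure (volume.restrict Ω : Measure V) :=
    ⟨by rw [Measure.restrict_apply_univ]; exact hb.lt_top⟩
  have hIoc : volume (Ioc s t) ≠ ⊤ := measure_Ioc_lt_top.ne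
  let z : L2 Ω ℝ := (((U₁ t).snd : L2 Ω ℝ) - ((U₂ t).snd : L2 Ω ℝ)) -
      (((U₁ s).snd : L2 Ω ℝ) - ((U₂ s).snd : L2 Ω ℝ))
  have hzi : Integrable z (volume.restrict Ω) := (Lp.memLp z).integrable (by norm_num)
  have hdi : Integrable (R.d D) ((volume.restrict (Ioc s t)).prod (volume.restrict Ω)) :=
    (MemLp.restrict_cylinder (R.memLp_d D) _ _).integrable (by norm_num)
  have hswap : ∀ {b : V → ℝ}, MemLp b 2 (volume.restrict Ω) →
      ∫ r in Ioc s t, ∫ x in Ω, inner ℝ (R.d D (r, x)) (b x) =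
      ∫ x in Ω, (∫ r in Ioc s t, R.d D (r, x)) * b x := by
    intro b hb2
    rw [integral_integral_swap (integrable_inner_snd (R.memLp_d D) hb2 hIoc)]
    simp_rw [real_inner_eq_mul, integral_mul_const]
  -- Since `div(Dw)` is a function, the tested identity holds pointwise almost everywhere, by the
  -- fundamental lemma of the calculus of variations. It can then be tested with any `L²` function.
  have hzero : ∀ᵐ x, x ∈ Ω → z x + ∫ r in Ioc s t, R.d D (r, x) = 0 := by
    refine hΩ.ae_eq_zero_of_integral_contDiff_smul_eq_zero ?_ ?_
    · exact IntegrableOn.locallyIntegrableOn (hzi.add hdi.integral_prod_right)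
    · intro η hη hηc hηs
      have hη2 : MemLp η 2 (volume.restrict Ω) :=
        (hη.continuous.memLp_of_hasCompactSupport hηc).restrict Ω
      obtain ⟨M, hM⟩ := hηc.exists_bound_of_continuous hη.continuous
      have key := R.pressure_increment_test hb hT h₁ h₂ hη hηc hηs hs hst ht
      rw [← inner_toLp_eq_integral _ hη2, ← inner_toLp_eq_integral _ hη2, ← inner_sub_right,
        inner_toLp_eq_integral, intervalIntegral.integral_of_le hst, integral_neg,
        hswap hη2] at key
      have i1 : Integrable (fun x => η x * z x) (volume.restrict Ω) :=
        hzi.bdd_mul hη.continuous.aestronglyMeasurable (.of_forall hM)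
      have i2 : Integrable (fun x => η x * ∫ r in Ioc s t, R.d D (r, x)) (volume.restrict Ω) :=
        hdi.integral_prod_right.bdd_mul hη.continuous.aestronglyMeasurable (.of_forall hM)
      rw [← setIntegral_eq_integral_of_forall_compl_eq_zero (s := Ω)]
      · simp only [smul_eq_mul, mul_add]
        rw [integral_add i1 i2]
        simp only [real_inner_eq_mul] at key
        simp only [mul_comm (η _)]
        linarith
      · intro x hx
        rw [image_eq_zero_of_notMem_tsupport fun h => hx (hηs h), zero_smul]
  rw [hswap (Lp.memLp χ), L2.inner_def, ← integral_neg]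
  refine integral_congr_ae ?_
  filter_upwards [(ae_restrict_iff' hΩ.measurableSet).2 hzero] with x hx
  rw [real_inner_eq_mul, ← neg_mul]
  congr 1
  linarith

end DifferenceReps

/-! ### The kernel of the difference system and its diagonal -/

/-- Separability is what turns weak continuity in the energy space into strong measurability. -/
lemma secondCountableTopology_E (Ω : Set V) : SecondCountableTopology (E Ω) := by
  have : Fact ((1 : ENNReal) ≤ 2) := ⟨by norm_num⟩
  have : Fact ((2 : ENNReal) ≠ ⊤) := ⟨by norm_num⟩
  have h₁ : SecondCountableTopology (L2 Ω V) := inferInstance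
  have h₂ : SecondCountableTopology (L2 Ω ℝ) := inferInstance
  have h₃ : SecondCountableTopology (L2bar Ω) := inferInstance
  exact (WithLp.homeomorphProd 2 (L2 Ω V) (L2bar Ω)).secondCountableTopology

/-- Pairing with a representative, in the whole space or in `Ω`. -/
lemma SpaceTimeRep.integral_inner {Ω : Set V} {T : ℝ} {F : Type} [NormedAddCommGroup F]
    [InnerProductSpace ℝ F] [MeasurableSpace F] {v : ℝ → L2 Ω F} {w : ℝ × V → F}
    (h : SpaceTimeRep Ω T v w) :
    ∀ᵐ t ∂(volume.restrict (Ioo 0 T)), ∀ a : V → F,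
      ∫ x, inner ℝ (a x) (w (t, x)) = ∫ x in Ω, inner ℝ (a x) (v t x) := by
  filter_upwards [h.ae_eq] with t ht a
  rw [← setIntegral_eq_integral_of_forall_compl_eq_zero (s := Ω)]
  · refine integral_congr_ae ?_
    filter_upwards [ht] with x hx
    rw [hx]
  · intro x hx
    rw [h.eq_zero (t, x) fun k => hx k.2, inner_zero_right]

lemma SpaceTimeRep.integral_inner_self {Ω : Set V} {T : ℝ} {F : Type} [NormedAddCommGroup F]
    [InnerProductSpace ℝ F] [MeasurableSpace F] {v : ℝ → L2 Ω F} {w : ℝ × V → F}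
    (h : SpaceTimeRep Ω T v w) :
    ∀ᵐ t ∂(volume.restrict (Ioo 0 T)), ∫ x, inner ℝ (w (t, x)) (w (t, x)) = ‖v t‖ ^ 2 := by
  filter_upwards [h.ae_eq, h.integral_inner] with t ht hi
  rw [hi, ← real_inner_self_eq_norm_sq, L2.inner_def]
  refine integral_congr_ae ?_
  filter_upwards [ht] with x hx
  rw [hx]

/-- The pointwise bound behind the energy estimate: completing the square absorbs the pressure
terms in the dissipation. -/
lemma pointwise_energy_bound (D : Matrix (Fin 3) (Fin 3) ℝ) (G : Fin 3 → V) (q : ℝ) :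
    (∑ i, inner ℝ (q • e i - G i) (G i)) - (∑ i, inner ℝ (G i) (WithLp.toLp 2 (D i))) * q ≤
      (∑ i, ‖e i - WithLp.toLp 2 (D i)‖ ^ 2 / 4) * q ^ 2 := by
  rw [Finset.sum_mul, Finset.sum_mul, ← Finset.sum_sub_distrib]
  refine Finset.sum_le_sum fun i _ => ?_
  -- The cross term of this square is exactly the sum of the two pressure contributions in direction
  -- `i`.
  have h := sq_nonneg ‖(q / 2) • (e i - WithLp.toLp 2 (D i)) - G i‖
  rw [norm_sub_sq_real, norm_smul, mul_pow, Real.norm_eq_abs, sq_abs, real_inner_smul_left,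
    inner_sub_left] at h
  rw [real_inner_comm (G i) (WithLp.toLp 2 (D i))] at h
  rw [inner_sub_left, real_inner_smul_left, real_inner_self_eq_norm_sq]
  linarith

namespace DifferenceReps

variable {Ω : Set V} {T l : ℝ} {f : V → V} {U₁ U₂ : ℝ → E Ω} (R : DifferenceReps Ω T l f U₁ U₂)
  (D : Matrix (Fin 3) (Fin 3) ℝ)

/-- The weak form of the difference system at time `σ`, tested with the difference at time `r`. -/
def kernel (σ r : ℝ) : ℝ :=
  (∑ i, ∫ x, inner ℝ (R.S i (σ, x)) (R.G i (r, x))) +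
    ((∫ x, inner ℝ (-R.h (σ, x)) (R.w (r, x))) + ∫ x, inner ℝ (-R.d D (σ, x)) (R.q (r, x)))

lemma measurable_h (hf : IsNonlinearity l f) : Measurable R.h :=
  (hf.measurable.comp R.rep_u₁.measurable).sub (hf.measurable.comp R.rep_u₂.measurable)

/-- Every term pairs dual exponents, and the factor shifted in time has a finite exponent, so its
translations are continuous. -/
lemma shiftContinuous_kernel (hf : IsNonlinearity l f) (c : ℝ) :
    ShiftContinuous c (R.kernel D) := by
  have h₁ : Fact (1 ≤ ENNReal.ofReal (2 * (l + 1) / (2 * l + 1))) :=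
    ⟨one_le_conjugate_exponent hf.1.1⟩
  have h₂ := holderConjugate_exponents hf.1.1
  refine (ShiftContinuous.sum fun i _ => ?_).add (.add ?_ ?_)
  · exact shiftContinuous_integral_inner (p := 2) (q := 2) (by norm_num) (R.measurable_S i)
      (R.rep_G i).measurable (R.memLp_S i) (R.rep_G i).memLp c
  · exact shiftContinuous_integral_inner ENNReal.ofReal_ne_top (R.measurable_h hf).neg
      R.rep_w.measurable R.memLp_h.neg R.memLp_w c
  · exact shiftContinuous_integral_inner (p := 2) (q := 2) (by norm_num) (R.measurable_d D).neg
      R.rep_q.measurable (R.memLp_d D).neg R.rep_q.memLp c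

/-- Representatives vanish off the cylinder; this matches freezing the difference at its initial
value for negative times. -/
lemma kernel_eq_zero {σ : ℝ} (hσ : σ ≤ 0) (r : ℝ) : R.kernel D σ r = 0 := by
  have hz : ∀ x : V, (σ, x) ∉ Ioo 0 T ×ˢ Ω := fun x k => hσ.not_gt k.1.1
  simp [kernel, S, d, h, q, fun i x => (R.rep_G i).eq_zero _ (hz x),
    fun x => R.rep_p₁.eq_zero _ (hz x), fun x => R.rep_p₂.eq_zero _ (hz x),
    fun x => R.rep_u₁.eq_zero _ (hz x), fun x => R.rep_u₂.eq_zero _ (hz x)]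

variable {D} {g : L2 Ω V}

/-- The increments of the difference of two solutions, tested with the difference itself. -/
theorem inner_increment (hΩ : IsOpen Ω) (hbd : Bornology.IsBounded Ω) (hT : 0 < T)
    (hf : IsNonlinearity l f) (h₁ : IsWeakEnergySolution Ω T l f D g U₁)
    (h₂ : IsWeakEnergySolution Ω T l f D g U₂) :
    ∀ᵐ r ∂(volume.restrict (Ioo 0 T)), ∀ s ∈ Icc 0 r,
      inner ℝ ((U₁ r - U₂ r) - (U₁ s - U₂ s)) (U₁ r - U₂ r) = ∫ σ in s..r, R.kernel D σ r := by
  have hb : volume Ω ≠ ⊤ := hbd.measure_lt_top.ne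
  have hconj := holderConjugate_exponents hf.1.1
  -- For almost every `r` the velocity difference is in `H¹₀` and may serve as the test field; the
  -- exceptional set does not depend on `s`.
  filter_upwards [ae_restrict_mem measurableSet_Ioo, R.mem_H10Graph, R.rep_w.integral_inner,
    ae_all_iff.2 fun i => (R.rep_G i).integral_inner, R.rep_q.integral_inner]
    with r hr hH hw hG hq s hs
  have hI : volume (Ioc s r) ≠ ⊤ := measure_Ioc_lt_top.ne
  have i1 : ∀ i, IntegrableOn (fun σ => ∫ x in Ω, inner ℝ (R.S i (σ, x)) (R.grad r i x))
      (Ioc s r) := fun i =>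
    (integrable_inner_snd (R.memLp_S i) (Lp.memLp (R.grad r i)) hI).integral_prod_left
  have i2 : IntegrableOn (fun σ => ∫ x in Ω, inner ℝ (R.h (σ, x))
      (((U₁ r).fst - (U₂ r).fst : L2 Ω V) x)) (Ioc s r) :=
    (integrable_inner_snd R.memLp_h (memLp_of_mem_H10Graph hbd hf.1 hH) hI).integral_prod_left
  have i3 : IntegrableOn (fun σ => ∫ x in Ω, inner ℝ (R.d D (σ, x))
      ((((U₁ r).snd : L2 Ω ℝ) - ((U₂ r).snd : L2 Ω ℝ) : L2 Ω ℝ) x)) (Ioc s r) :=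
    (integrable_inner_snd (R.memLp_d D) (Lp.memLp _) hI).integral_prod_left
  have e1 := R.momentum_increment hbd hT hf.1 h₁ h₂ hH hs.1 hs.2 hr.2.le
  have e2 := R.pressure_increment hΩ hb hT h₁ h₂
    (((U₁ r).snd : L2 Ω ℝ) - ((U₂ r).snd : L2 Ω ℝ)) hs.1 hs.2 hr.2.le
  have e3 : inner ℝ ((U₁ r - U₂ r) - (U₁ s - U₂ s)) (U₁ r - U₂ r) =
      inner ℝ (((U₁ r).fst - (U₂ r).fst) - ((U₁ s).fst - (U₂ s).fst))
        ((U₁ r).fst - (U₂ r).fst) +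
      inner ℝ ((((U₁ r).snd : L2 Ω ℝ) - ((U₂ r).snd : L2 Ω ℝ)) -
        (((U₁ s).snd : L2 Ω ℝ) - ((U₂ s).snd : L2 Ω ℝ)))
        (((U₁ r).snd : L2 Ω ℝ) - ((U₂ r).snd : L2 Ω ℝ)) := by
    rw [WithLp.prod_inner_apply]; rfl
  rw [e3, e1, e2, intervalIntegral.integral_of_le hs.2]
  simp only [kernel, hw, hG, hq, inner_neg_left, integral_neg]
  refine Eq.symm ((integral_add (integrable_finsetSum _ fun i _ => i1 i)
    (i2.neg.add i3.neg)).trans ?_)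
  rw [integral_add' i2.neg i3.neg, integral_neg', integral_neg',
    integral_finsetSum _ fun i _ => i1 i]
  ring

/-- On the diagonal the kernel is controlled by the energy of the difference. -/
theorem kernel_diag_le (hf : IsNonlinearity l f) {K : ℝ}
    (hK : ∀ u v, -K * ‖u - v‖ ^ 2 ≤ inner ℝ (f u - f v) (u - v)) (hK0 : 0 < K) :
    ∀ᵐ r ∂(volume.restrict (Ioo 0 T)),
      R.kernel D r r ≤ (K + ∑ i, ‖e i - WithLp.toLp 2 (D i)‖ ^ 2 / 4) * ‖U₁ r - U₂ r‖ ^ 2 := by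
  have hconj := holderConjugate_exponents hf.1.1
  have slice : ∀ {a : ℝ × V → ℝ}, Integrable a →
      ∀ᵐ r ∂(volume.restrict (Ioo 0 T)), Integrable (fun x => a (r, x)) := fun ha =>
    ae_restrict_of_ae (Integrable.prod_right_ae ha)
  filter_upwards [R.rep_w.integral_inner_self, R.rep_q.integral_inner_self,
    ae_all_iff.2 fun i => slice (integrable_inner_of_memLp (R.memLp_S i) (R.rep_G i).memLp),
    slice (integrable_inner_of_memLp R.memLp_h.neg R.memLp_w),
    slice (integrable_inner_of_memLp (R.memLp_d D).neg R.rep_q.memLp),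
    slice (integrable_inner_of_memLp R.rep_w.memLp R.rep_w.memLp),
    slice (integrable_inner_of_memLp R.rep_q.memLp R.rep_q.memLp)] with r hw hq i1 i2 i3 i4 i5
  set A := ∑ i, ‖e i - WithLp.toLp 2 (D i)‖ ^ 2 / 4 with hA
  have hA0 : 0 ≤ A := Finset.sum_nonneg fun i _ => by positivity
  have e1 : ‖U₁ r - U₂ r‖ ^ 2 = ‖(U₁ r).fst - (U₂ r).fst‖ ^ 2 +
      ‖((U₁ r).snd : L2 Ω ℝ) - ((U₂ r).snd : L2 Ω ℝ)‖ ^ 2 := by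
    rw [WithLp.prod_norm_sq_eq_of_L2]; rfl
  have e2 : R.kernel D r r = ∫ x, ((∑ i, inner ℝ (R.S i (r, x)) (R.G i (r, x))) +
      (inner ℝ (-R.h (r, x)) (R.w (r, x)) + inner ℝ (-R.d D (r, x)) (R.q (r, x)))) := by
    rw [kernel, ← integral_finsetSum _ fun i _ => i1 i]
    erw [← integral_add i2 i3, ← integral_add (integrable_finsetSum _ fun i _ => i1 i) (i2.add i3)]
    rfl
  have e3 : R.kernel D r r ≤ ∫ x, (K * inner ℝ (R.w (r, x)) (R.w (r, x)) +
      A * inner ℝ (R.q (r, x)) (R.q (r, x))) := by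
    rw [e2]
    refine integral_mono ((integrable_finsetSum _ fun i _ => i1 i).add (i2.add i3))
      ((i4.const_mul K).add (i5.const_mul A)) fun x => ?_
    have k1 := hK (R.u₁ (r, x)) (R.u₂ (r, x))
    have k2 := pointwise_energy_bound D (fun i => R.G i (r, x)) (R.q (r, x))
    simp only [inner_neg_left, real_inner_self_eq_norm_sq, real_inner_eq_mul (R.d D (r, x)),
      Real.norm_eq_abs, sq_abs]
    change _ ≤ inner ℝ (R.h (r, x)) (R.w (r, x)) at k1
    change _ ≤ K * ‖R.u₁ (r, x) - R.u₂ (r, x)‖ ^ 2 + _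
    change (∑ i, inner ℝ (R.S i (r, x)) (R.G i (r, x))) - R.d D (r, x) * R.q (r, x) ≤ _ at k2
    linarith
  rw [integral_add (i4.const_mul K) (i5.const_mul A), integral_const_mul, integral_const_mul, hw,
    hq] at e3
  rw [e1]
  nlinarith [sq_nonneg ‖(U₁ r).fst - (U₂ r).fst‖,
    sq_nonneg ‖((U₁ r).snd : L2 Ω ℝ) - ((U₂ r).snd : L2 Ω ℝ)‖]

end DifferenceReps

/-! ### Conclusion -/

/-- Lipschitz dependence of weak energy solutions on their initial data. -/
theorem IsWeakEnergySolution.norm_sub_sq_le {Ω : Set V} (hΩ : IsOpen Ω)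
    (hbd : Bornology.IsBounded Ω) {T l : ℝ} (hT : 0 < T) {f : V → V} (hf : IsNonlinearity l f)
    {D : Matrix (Fin 3) (Fin 3) ℝ} {g : L2 Ω V} {K : ℝ} (hK0 : 0 < K)
    (hK : ∀ u v, -K * ‖u - v‖ ^ 2 ≤ inner ℝ (f u - f v) (u - v)) {U₁ U₂ : ℝ → E Ω}
    (h₁ : IsWeakEnergySolution Ω T l f D g U₁) (h₂ : IsWeakEnergySolution Ω T l f D g U₂) :
    ∀ t ∈ Icc 0 T, ‖U₁ t - U₂ t‖ ^ 2 ≤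
      2 * Real.exp (4 * (K + ∑ i, ‖e i - WithLp.toLp 2 (D i)‖ ^ 2 / 4) * t) *
        ‖U₁ 0 - U₂ 0‖ ^ 2 := by
  have hb : volume Ω ≠ ⊤ := hbd.measure_lt_top.ne
  have hE := secondCountableTopology_E Ω
  have hL := completeSpace_L2bar hb
  obtain ⟨R⟩ := nonempty_differenceReps hΩ hb hT hf h₁ h₂
  set M := K + ∑ i, ‖e i - WithLp.toLp 2 (D i)‖ ^ 2 / 4
  have hM : 0 < M := add_pos_of_pos_of_nonneg hK0 (Finset.sum_nonneg fun i _ => by positivity)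
  -- Freezing the difference outside `[0, T]` makes it weakly continuous and bounded on the whole
  -- line.
  let W : ℝ → E Ω := fun t => U₁ (projIcc 0 T hT.le t) - U₂ (projIcc 0 T hT.le t)
  have hWeq : ∀ t ∈ Icc 0 T, W t = U₁ t - U₂ t := fun t ht => by
    simp only [W, projIcc_of_mem hT.le ht]
  have hwc : ∀ v, ContinuousOn (fun t => inner ℝ v (U₁ t - U₂ t)) (Icc 0 T) := fun v => by
    simp_rw [inner_sub_right]
    exact (h₁.weakly_continuous v).sub (h₂.weakly_continuous v)
  have hW : ∀ v, Continuous fun t => inner ℝ v (W t) := fun v =>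
    (hwc v).comp_continuous (by fun_prop) fun x => (projIcc 0 T hT.le x).2
  have hWm : Measurable fun t => ‖W t‖ :=
    (stronglyMeasurable_of_weakly_continuous hW).norm.measurable
  obtain ⟨B, hB⟩ := exists_norm_le_of_weakly_continuousOn isCompact_Icc hwc
  have hWb : ∀ t, ‖W t‖ ≤ B := fun t => hB _ (projIcc 0 T hT.le t).2
  have hneg : ∀ t ≤ 0, W t = W 0 := fun t ht => by
    simp only [W, projIcc_of_le_left hT.le ht, projIcc_of_le_left hT.le le_rfl]
  have hae : ∀ c ∈ Ioc 0 T, ∀ {P : ℝ → Prop}, (∀ᵐ r ∂(volume.restrict (Ioo 0 T)), P r) →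
      ∀ᵐ r ∂(volume.restrict (Ioc 0 c)), P r := fun c hc P h => by
    rw [Measure.restrict_congr_set Ioo_ae_eq_Ioc] at h
    exact ae_mono (Measure.restrict_mono (Ioc_subset_Ioc_right hc.2) le_rfl) h
  have henergy : ∀ c ∈ Ioc 0 T,
      ‖W c‖ ^ 2 ≤ ‖W 0‖ ^ 2 + 2 * M * ∫ r in Ioc 0 c, ‖W r‖ ^ 2 := by
    intro c hc
    have hB := R.shiftContinuous_kernel D hf c
    have h := energy_inequality hW hWm ⟨B, hWb⟩ hneg hc.1 hB (by
      filter_upwards [hae c hc (R.inner_increment hΩ hbd hT hf h₁ h₂),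
        ae_restrict_mem measurableSet_Ioc] with r hr hrc s hs
      -- A negative `s` can be replaced by `0`: neither `W s` nor the integral changes, since the
      -- kernel vanishes for `σ ≤ 0`.
      have hs0 : max s 0 ∈ Icc 0 r := ⟨le_max_right _ _, max_le hs hrc.1.le⟩
      have hWs : W s = W (max s 0) := by
        rcases le_total s 0 with k | k
        · rw [hneg s k, max_eq_right k]
        · rw [max_eq_left k]
      have hrT : r ≤ T := hrc.2.trans hc.2
      rw [hWs, hWeq r ⟨hrc.1.le, hrT⟩, hWeq _ ⟨hs0.1, hs0.2.trans hrT⟩, hr _ hs0,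
        intervalIntegral.integral_of_le hs, intervalIntegral.integral_of_le hs0.2]
      refine (setIntegral_eq_of_subset_of_forall_sdiff_eq_zero measurableSet_Ioc
        (Ioc_subset_Ioc_left (le_max_left _ _)) fun σ hσ => ?_).symm
      refine R.kernel_eq_zero D ?_ r
      by_contra! k
      exact hσ.2 ⟨max_lt hσ.1.1 k, hσ.1.2⟩)
    have hi : IntegrableOn (fun r => M * ‖W r‖ ^ 2) (Ioc 0 c) := by
      refine Integrable.const_mul ?_ M
      refine Measure.integrableOn_of_bounded (M := B ^ 2) measure_Ioc_lt_top.ne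
        (hWm.pow_const 2).aestronglyMeasurable (.of_forall fun r => ?_)
      rw [norm_pow, norm_norm]
      exact pow_le_pow_left₀ (norm_nonneg _) (hWb r) 2
    have hd : IntegrableOn (fun r => R.kernel D r r) (Ioc 0 c) := by
      simpa only [sub_zero] using hB.integrableOn 0
    have h2 : ∫ r in Ioc 0 c, R.kernel D r r ≤ ∫ r in Ioc 0 c, M * ‖W r‖ ^ 2 := by
      refine integral_mono_ae hd hi ?_
      filter_upwards [hae c hc (R.kernel_diag_le hf hK hK0), ae_restrict_mem measurableSet_Ioc]
        with r hr hrc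
      rwa [hWeq r ⟨hrc.1.le, hrc.2.trans hc.2⟩]
    rw [integral_const_mul] at h2
    linarith
  intro t ht
  -- The energy inequality has rate `2M` and the Gronwall lemma doubles it, hence `4M`.
  have key := le_two_mul_exp_of_integral_le (y := fun t => ‖W t‖ ^ 2) (K := 2 * M) (M := B ^ 2)
    (by positivity) hT.le (hWm.pow_const 2) (fun t => by positivity)
    (fun t => pow_le_pow_left₀ (norm_nonneg _) (hWb t) 2) henergy t ht
  simp only [hWeq t ht, hWeq 0 ⟨le_rfl, hT.le⟩] at key
  rwa [show 2 * (2 * M) * t = 4 * M * t by ring] at key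

end BrinkmanForchheimer

end

theorem theorem1 (l : ℝ) (f : BrinkmanForchheimer.V → BrinkmanForchheimer.V)
    (hf : BrinkmanForchheimer.IsNonlinearity l f)
    (D : Matrix (Fin 3) (Fin 3) ℝ) (hD : D.PosDef) :
    ∃ C K : ℝ, 0 < C ∧ 0 < K ∧
      ∀ Ω : Set BrinkmanForchheimer.V, IsOpen Ω → IsConnected Ω → Bornology.IsBounded Ω →
      ∀ (g : BrinkmanForchheimer.L2 Ω BrinkmanForchheimer.V) (T : ℝ), 0 < T →
      ∀ U₁ U₂ : ℝ → BrinkmanForchheimer.E Ω,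
        BrinkmanForchheimer.IsWeakEnergySolution Ω T l f D g U₁ →
        BrinkmanForchheimer.IsWeakEnergySolution Ω T l f D g U₂ →
        (∀ t ∈ Set.Icc 0 T, ‖U₁ t - U₂ t‖ ^ 2 ≤ C * Real.exp (K * t) * ‖U₁ 0 - U₂ 0‖ ^ 2) ∧
        (U₁ 0 = U₂ 0 → ∀ t ∈ Set.Icc 0 T, U₁ t = U₂ t) := by
  obtain ⟨K, hK0, hK⟩ := hf.inner_sub_ge
  -- The monotonicity constant `K` depends on `f` alone and the sum on `D` alone, so the choice is
  -- made before `Ω`, `g` and `T`.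
  refine ⟨2, 4 * (K + ∑ i, ‖BrinkmanForchheimer.e i - WithLp.toLp 2 (D i)‖ ^ 2 / 4), two_pos,
    mul_pos four_pos (add_pos_of_pos_of_nonneg hK0 (Finset.sum_nonneg fun i _ => by positivity)),
    fun Ω hΩ _ hbd g T hT U₁ U₂ h₁ h₂ => ?_⟩
  have key := h₁.norm_sub_sq_le hΩ hbd hT hf hK0 hK h₂
  refine ⟨key, fun h0 t ht => sub_eq_zero.1 (norm_eq_zero.1 ?_)⟩
  have h := key t ht
  rw [h0, sub_self, norm_zero, zero_pow two_ne_zero, mul_zero] at h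
  exact pow_eq_zero_iff two_ne_zero |>.1 (le_antisymm h (sq_nonneg _))
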